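/- Counter-examples to monotonicity of the best-choice problem relative to the stochastic order. Model. $n$ items ranked $1,\dots,n$ (rank $1$ is the best) arrive at independent uniform times on $[0,1]$. At each arrival Alice observes the times and the relative ranks of all arrivals so far; a record is an arrival of relative rank $1$. A stopping strategy $\tau$ decides (measurably) at each record, on the basis of this history only, whether to stop there; it does not know $n$. $W(\tau,n)$ is the probability that $\tau$ stops at the overall best item, and $W(\tau,\nu)=\sum_{n\ge1}\nu_nW(\tau,n)$ for a probability distribution $\nu$ on $\{1,2,\dots\}$. A strategy is $\nu$-optimal if it achieves $\max W(\cdot,\nu)$. Under the alternative convention not stopping pays $1$ when $n=1$ (this event otherwise pays $0$). Write $\nu\prec\nu'$ if $\nu\ne\nu'$ and $\nu[m,\infty)\le\nu'[m,\infty)$ for all $m$. The index of a record is the number of items seen so far; the strategy with cutoffs $a_1,a_2,\dots$ stops at the first record whose index $k$ and time $t$ satisfy $t\ge a_k$. The $d$-strategy stops at the first record of index at least $d$; put $s(d,n)=\frac{d-1}{n}\sum_{j=d}^n\frac1{j-1}$ for $d>1$. (I) Under each of the two conventions, there are $\nu\prec\nu'$, for both of which optimal strategies exist, such that the optimal payoff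 against $\nu'$ is strictly larger than the optimal payoff against $\nu$. In particular, the assertion "$\nu\prec\nu'$ implies $\sup W(\cdot,\nu')\le\sup W(\cdot,\nu)$" (Theorem 2.3 of Bruss and Samuels in the best-choice setting) is false, and so is its analogue under the alternative convention. (II) For $p\in[0,1]$ let $\nu^{(p)}$ have masses $1-p$ at $1$ and $p$ at $4$; it is strictly increasing in $p$ in the stochastic order. For $b\in[0,1]$ let $\tau_b$ have cutoffs $a_1=1-b$ and $a_k=0$ for $k\ge2$. Then $$W(\tau_b,\nu^{(p)})=w(b,p):=(1-p)b+p\Big((1-b^4)s(2,4)+\frac{b^4}{4}\Big)=(1-p)b+\frac p{24}(11-5b^4).$$ If $p\le 6/11$, then $\tau_1$ is $\nu^{(p)}$-optimal. If $p>6/11$, then there is $b(p)\in[0,1)$, with $b(p)>0$ when $p<1$, such that $w(\cdot,p)$ is strictly increasing on $[0,b(p)]$ and strictly decreasing on $[b(p),1]$, and $\tau_{b(p)}$ is $\nu^{(p)}$-optimal. Moreover $\nu^{(1)}=\delta_4$, the $2$-strategy is optimal for $n=4$, and $\max W(\cdot,4)=s(2,4)=11/24$. The equation $-b+\frac1{24}(11-5b^4)=0$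 has exactly one root $b^*\in[0,1]$, $0.449<b^*<0.450$, and there is $p^*$ with $0.929<p^*<0.930$ such that: $w(b^*,p)=b^*$ for all $p\in[0,1]$; $w(b,p^*)\le w(b^*,p^*)$ for all $b\in[0,1]$; $\tau_{b^*}$ is $\nu^{(p^*)}$-optimal, and $\max W(\cdot,\nu^{(p^*)})=b^*<s(2,4)=\max W(\cdot,4)$ although $\nu^{(p^*)}\prec\delta_4$; $b^*\le\max W(\cdot,\nu^{(p)})$ for all $p$; $b^*<\max W(\cdot,\nu^{(p)})\le s(2,4)$ for $p\in(p^*,1]$; and $p\mapsto\max W(\cdot,\nu^{(p)})$ is strictly increasing on $[p^*,1]$. (III) For $p\in[0,1]$ let $\nu^{(p)}$ have masses $1-p$ at $3$ and $p$ at $6$; it is strictly increasing in $p$ in the stochastic order, and the two conventions give the same payoff against it. For $b\in[0,1]$ let $\tau_b$ have cutoffs $a_1=1$, $a_2=1-b$ and $a_k=0$ for $k\ge3$. With $\beta(k,n)=\binom nk(1-b)^kb^{n-k}$ and $$f_n(b)=[\beta(0,n)+\beta(1,n)]\,s(2,n)+\Big[\sum_{k=2}^n\beta(k,n)\Big]s(3,n)$$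 one has $W(\tau_b,n)=f_n(b)$ for $n=3,6$ and $W(\tau_b,\nu^{(p)})=w(b,p):=(1-p)f_3(b)+pf_6(b)$. The strategy $\tau_{b(p)}$ is $\nu^{(p)}$-optimal for $b(p)=1$ if $p\le12/29=0.413\ldots$, and for $b(p)=\big(\frac{12(1-p)}{17p}\big)^{1/3}$ if $p>12/29$. The equation $f_3(b)=f_6(b)$ has exactly one root $b^*\in[0,1]$, $0.520<b^*<0.521$; it is also the only root in $[0,1]$ of $\frac{17}{72}b^6-\frac{17}{60}b^5+\frac13b^3-\frac12b^2+\frac{17}{180}=0$. There are $p^*$ and $v$ with $0.833<p^*<0.834$ and $0.421<v<0.422$ such that: $w(b^*,p)=v$ for all $p\in[0,1]$; $w(b,p^*)\le w(b^*,p^*)$ for all $b\in[0,1]$; $\tau_{b^*}$ is $\nu^{(p^*)}$-optimal with $\max W(\cdot,\nu^{(p^*)})=v\le\max W(\cdot,\nu^{(p)})$ for all $p$; and $p\mapsto\max W(\cdot,\nu^{(p)})$ is strictly increasing on $[p^*,1]$. -/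

import Mathlib

namespace BestChoice

open MeasureTheory

/-- A (pure) stopping strategy of Alice. The history at the `(k+1)`-st arrival consists of the
first `k+1` arrival times in chronological order and of the relative ranks of these arrivals;
`accept k` is the (measurable) set of histories at which the `(k+1)`-st arrival is acceptable.
Only records (arrivals of relative rank `1`) may be acceptable. Alice stops at the
first acceptable arrival, if there is one. -/
structure Strategy where
  accept : (k : ℕ) → Set ((Fin (k + 1) → ℝ) × (Fin (k + 1) → ℕ))
  measurableSet_accept : ∀ k, MeasurableSet (accept k)
  record_of_mem : ∀ k, ∀ h ∈ accept k, h.2 (Fin.last k) = 1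

/-- The history of a data sequence `x` of length `n` up to and including entry `k`. -/
def prefixTo {α : Type*} {n : ℕ} (x : Fin n → α) (k : Fin n) : Fin (k.val + 1) → α :=
  fun i => x (Fin.castLE k.isLt i)

/-- With chronological arrival times `t` and relative ranks `r`, the `k`-th arrival
(counted from `0`) is acceptable. -/
def Strategy.Accepts (τ : Strategy) {n : ℕ} (t : Fin n → ℝ) (r : Fin n → ℕ) (k : Fin n) : Prop :=
  (prefixTo t k, prefixTo r k) ∈ τ.accept k.val

/-- Alice stops at the `k`-th arrival (counted from `0`). -/
def Strategy.StopsAt (τ : Strategy) {n : ℕ} (t : Fin n → ℝ) (r : Fin n → ℕ) (k : Fin n) : Prop :=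
  τ.Accepts t r k ∧ ∀ j < k, ¬ τ.Accepts t r j

/-- Alice stops at a record that is followed by no further record. -/
def Strategy.Wins (τ : Strategy) {n : ℕ} (t : Fin n → ℝ) (r : Fin n → ℕ) : Prop :=
  ∃ k, τ.StopsAt t r k ∧ r k = 1 ∧ ∀ j, k < j → r j ≠ 1

/-- The law of the arrival times of `n` items: independent, uniformly distributed on `[0,1]`.
Coordinate `i` is the arrival time of the item that has rank `i + 1` among all `n` items
(so item `0` is the best one). -/
noncomputable def arrivalLaw (n : ℕ) : Measure (Fin n → ℝ) :=
  Measure.pi fun _ => volume.restrict (Set.Icc (0 : ℝ) 1)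

/-- The arrival times in chronological order; `Tuple.sort u k` is the item arriving `k`-th. -/
noncomputable def orderedTimes {n : ℕ} (u : Fin n → ℝ) (k : Fin n) : ℝ := u (Tuple.sort u k)

/-- The rank of the `k`-th arrival relative to all items seen so far (itself included). -/
noncomputable def relRank {n : ℕ} (u : Fin n → ℝ) (k : Fin n) : ℕ :=
  (Finset.univ.filter fun j : Fin n => j ≤ k ∧ Tuple.sort u j ≤ Tuple.sort u k).card

/-- `W(τ, n)`: the probability that `τ` wins when there are `n` items. -/
noncomputable def winProb (τ : Strategy) (n : ℕ) : ℝ :=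
  (arrivalLaw n).real {u | τ.Wins (orderedTimes u) (relRank u)}

/-- The probability that `τ` never stops when there are `n` items. -/
noncomputable def noStopProb (τ : Strategy) (n : ℕ) : ℝ :=
  (arrivalLaw n).real {u | ∀ k, ¬ τ.StopsAt (orderedTimes u) (relRank u) k}

/-- `W(τ, ν) = ∑ₙ νₙ W(τ, n)`, the winning probability when the number of items has law `ν`. -/
noncomputable def W (τ : Strategy) (ν : PMF ℕ+) : ℝ :=
  ∑' n : ℕ+, (ν n).toReal * winProb τ n

/-- The expected payoff under the alternative convention, in which not stopping is also rewarded
by `1` if there is just one item. -/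
noncomputable def altW (τ : Strategy) (ν : PMF ℕ+) : ℝ :=
  W τ ν + (ν 1).toReal * noStopProb τ 1

/-- `τ` achieves `max F(·, ν)`. -/
def IsOptimal (F : Strategy → PMF ℕ+ → ℝ) (τ : Strategy) (ν : PMF ℕ+) : Prop :=
  ∀ σ, F σ ν ≤ F τ ν

/-- `sup F(·, ν)`; it is `max F(·, ν)` as soon as an optimal strategy exists. -/
noncomputable def optValue (F : Strategy → PMF ℕ+ → ℝ) (ν : PMF ℕ+) : ℝ :=
  ⨆ τ, F τ ν

/-- The strict stochastic order: `ν'` differs from `ν` and has heavier tails. -/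
def StochLT (ν ν' : PMF ℕ+) : Prop :=
  ν ≠ ν' ∧ ∀ m : ℕ+, ν.toOuterMeasure (Set.Ici m) ≤ ν'.toOuterMeasure (Set.Ici m)

/-- Monotonicity relative to the stochastic order: the stochastically larger the
number of items, the smaller the optimal payoff. -/
def StochMonotone (F : Strategy → PMF ℕ+ → ℝ) : Prop :=
  ∀ ν ν', StochLT ν ν' → optValue F ν' ≤ optValue F ν

/-- The law with masses `1 - p` at `m` and `p` at `n`. -/
noncomputable def twoPoint (m n : ℕ+) (p : Set.Icc (0 : ℝ) 1) : PMF ℕ+ :=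
  ⟨fun k => (if k = m then ENNReal.ofReal (1 - p) else 0) +
      (if k = n then ENNReal.ofReal p else 0), by
    have h := (hasSum_ite_eq m (ENNReal.ofReal (1 - (p : ℝ)))).add
      (hasSum_ite_eq n (ENNReal.ofReal (p : ℝ)))
    rwa [← ENNReal.ofReal_add (sub_nonneg.2 p.2.2) p.2.1, sub_add_cancel,
      ENNReal.ofReal_one] at h⟩

/-- The strategy with cutoffs `a 1, a 2, …`: stop at the first record such that its
index `k` (the number of items seen so far) and its time `t` satisfy `t ≥ a k`. -/
def cutoffStrategy (a : ℕ → ℝ) : Strategy where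
  accept k := {h | a (k + 1) ≤ h.1 (Fin.last k) ∧ h.2 (Fin.last k) = 1}
  measurableSet_accept k := by
    have h1 : Measurable fun h : (Fin (k + 1) → ℝ) × (Fin (k + 1) → ℕ) => h.1 (Fin.last k) := by
      fun_prop
    have h2 : Measurable fun h : (Fin (k + 1) → ℝ) × (Fin (k + 1) → ℕ) => h.2 (Fin.last k) := by
      fun_prop
    exact (measurableSet_le measurable_const h1).inter (h2 (measurableSet_singleton 1))
  record_of_mem _ _ h := h.2

/-- The `d`-strategy stops at the first record of index at least `d`. (A cutoff `1` means
that the record is rejected almost surely.) -/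
noncomputable def dStrategy (d : ℕ) : Strategy :=
  cutoffStrategy fun k => if k < d then 1 else 0

/-- `s(d, n) = (d - 1) / n * ∑_{j = d}^{n} 1 / (j - 1)` for `d > 1`, and `s(1, n) = 1 / n`. -/
noncomputable def s (d n : ℕ) : ℝ :=
  if d = 1 then 1 / n else ((d : ℝ) - 1) / n * ∑ j ∈ Finset.Icc d n, 1 / ((j : ℝ) - 1)

/-- Cutoffs `a 1 = 1 - b` and `a k = 0` for `k ≥ 2`. -/
noncomputable def strategyA (b : ℝ) : Strategy :=
  cutoffStrategy fun k => if k = 1 then 1 - b else 0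

/-- Cutoffs `a 1 = 1`, `a 2 = 1 - b` and `a k = 0` for `k ≥ 3`. -/
noncomputable def strategyB (b : ℝ) : Strategy :=
  cutoffStrategy fun k => if k = 1 then 1 else if k = 2 then 1 - b else 0

/-- The payoff of `strategyA b` against the law with masses `1 - p` at `1` and `p` at `4`. -/
noncomputable def wA (b p : ℝ) : ℝ :=
  (1 - p) * b + p * ((1 - b ^ 4) * s 2 4 + b ^ 4 / 4)

/-- The probability of `k` arrivals out of `n` before time `1 - b`. -/
noncomputable def binom (b : ℝ) (k n : ℕ) : ℝ := (n.choose k) * (1 - b) ^ k * b ^ (n - k)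

/-- The winning probability of `strategyB b` with `n` items, for `n = 3` and `n = 6`. -/
noncomputable def fB (n : ℕ) (b : ℝ) : ℝ :=
  (binom b 0 n + binom b 1 n) * s 2 n + (∑ k ∈ Finset.Icc 2 n, binom b k n) * s 3 n

/-- The payoff of `strategyB b` against the law with masses `1 - p` at `3` and `p` at `6`. -/
noncomputable def wB (b p : ℝ) : ℝ := (1 - p) * fB 3 b + p * fB 6 b

end BestChoice

open BestChoice

/-! Each example is a saddle point of a game between Alice and a chooser of `p`. Against a two-point
law the payoff of a fixed strategy is affine in `p`. For the cutoff `b` at which its winning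
probabilities against the two numbers of items agree, the payoff is the same `v` for every `p`, so
the optimal value is never below `v`. If `p` is then chosen so that this `b` is optimal, the value
there is exactly `v`. For larger `p` the optimal `b` is smaller and favours the larger number of
items; hence the value increases strictly, while the law increases stochastically. The example on
{3, 6} alone refutes monotonicity under both conventions, since neither point of its support is `1`.

The optimality claims rest on a dynamic program in unnormalised weights. By symmetry the arrival
times and relative ranks of `n` items have a law given by an iterated integral
(`arrivalLaw_eq_expect`): each of the `n!` sequences of relative ranks carries Lebesgue measure on a
simplex of ordered times. In this normalisation, stopping at a record of index `k + 1` with time `y`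
left is worth `(n - 1).choose k * y ^ (n - 1 - k)`. This is the product of `n.choose (k + 1) * y ^
(n - k - 1)`, the density of the observed history relative to that of `k + 1` items, and `(k + 1) /
n`, the chance that the record is the overall best. Mixing over `n` just mixes these weights, and no
posterior law of `n` is needed.

The value `U k y` of waiting after `k` arrivals with time `y` left satisfies a backward integral
equation: of the `k + 1` possible ranks of the next arrival one is a record, worth the better of
stopping and waiting, and the other `k` force waiting. `payoff_le` and `payoff_cutoffStrategy` are
the resulting verification theorem; `valueA` and `valueB` solve the equation explicitly. Stopping
and waiting then balance at one time left, with `c * p * b ^ 3 = 1 - p` for `c = 5/6` on {1, 4} and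
`c = 17/12` on {3, 6}. -/

namespace BestChoice
open MeasureTheory
open scoped ENNReal

/-! ### Histories and iterated integration over the next arrival -/

/-- The time of the last arrival of a history, and `0` for the empty history. -/
def lastTime {n : ℕ} (t : Fin n → ℝ) : ℝ := (Fin.cons 0 t : Fin (n + 1) → ℝ) (Fin.last n)

@[simp] lemma lastTime_zero (t : Fin 0 → ℝ) : lastTime t = 0 := rfl

@[simp] lemma lastTime_succ {n : ℕ} (t : Fin (n + 1) → ℝ) : lastTime t = t (Fin.last n) := by
  rw [lastTime, ← Fin.succ_last, Fin.cons_succ]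

lemma measurable_lastTime {n : ℕ} : Measurable (lastTime : (Fin n → ℝ) → ℝ) := by
  cases n with
  | zero => exact measurable_const
  | succ n =>
    have : (lastTime : (Fin (n + 1) → ℝ) → ℝ) = fun t => t (Fin.last n) := funext lastTime_succ
    rw [this]
    fun_prop

/-- Histories of length `n`: arrival times and relative ranks. -/
abbrev History (n : ℕ) := (Fin n → ℝ) × (Fin n → ℕ)

/-- Extension of a history by one arrival. -/
def History.push {n : ℕ} (h : History n) (x : ℝ) (i : ℕ) : History (n + 1) :=
  (Fin.snoc h.1 x, Fin.snoc h.2 i)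

lemma measurable_push {n : ℕ} (i : ℕ) :
    Measurable fun q : History n × ℝ => q.1.push q.2 i := by
  refine Measurable.prodMk (measurable_pi_iff.2 fun j => ?_) (measurable_pi_iff.2 fun j => ?_)
  · refine Fin.lastCases ?_ (fun j => ?_) j
    · simpa using measurable_snd
    · simp only [Fin.snoc_castSucc]; fun_prop
  · refine Fin.lastCases ?_ (fun j => ?_) j
    · simp
    · simp only [Fin.snoc_castSucc]; fun_prop

/-- Sum over the next relative rank, and integral over the next arrival time. -/
noncomputable def stepIntegral {n : ℕ} (F : History (n + 1) → ℝ≥0∞) (h : History n) : ℝ≥0∞ :=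
  ∑ i ∈ Finset.Icc 1 (n + 1), ∫⁻ x in Set.Ioc (lastTime h.1) 1, F (h.push x i)

/-- The expectation of a function of the history of all `n` arrivals. -/
noncomputable def expect : (n : ℕ) → (History n → ℝ≥0∞) → ℝ≥0∞
  | 0, F => F (Fin.elim0, Fin.elim0)
  | n + 1, F => expect n (stepIntegral F)

lemma expect_succ {n : ℕ} (F : History (n + 1) → ℝ≥0∞) :
    expect (n + 1) F = expect n (stepIntegral F) := rfl

lemma measurable_stepIntegral {n : ℕ} {F : History (n + 1) → ℝ≥0∞} (hF : Measurable F) :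
    Measurable (stepIntegral F) := by
  refine Finset.measurable_sum _ fun i _ => ?_
  have hs : MeasurableSet {q : History n × ℝ | q.2 ∈ Set.Ioc (lastTime q.1.1) 1} :=
    (measurableSet_lt (measurable_lastTime.comp (measurable_fst.comp measurable_fst))
      measurable_snd).inter (measurableSet_le measurable_snd measurable_const)
  have := ((hF.comp (measurable_push i)).indicator hs).lintegral_prod_right' (ν := volume)
  convert this using 2 with h
  rw [← lintegral_indicator measurableSet_Ioc]
  rfl

lemma expect_mono {n : ℕ} {F G : History n → ℝ≥0∞}
    (hFG : ∀ h : History n, lastTime h.1 ∈ Set.Icc (0 : ℝ) 1 → F h ≤ G h) :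
    expect n F ≤ expect n G := by
  induction n with
  | zero => exact hFG _ (by simp)
  | succ n ih =>
    refine ih fun h hh => Finset.sum_le_sum fun i _ => ?_
    refine setLIntegral_mono' measurableSet_Ioc fun x hx => hFG _ ?_
    simp only [History.push, lastTime_succ, Fin.snoc_last]
    exact ⟨hh.1.trans hx.1.le, hx.2⟩

lemma expect_congr {n : ℕ} {F G : History n → ℝ≥0∞}
    (hFG : ∀ h : History n, lastTime h.1 ∈ Set.Icc (0 : ℝ) 1 → F h = G h) :
    expect n F = expect n G :=
  le_antisymm (expect_mono fun h hh => (hFG h hh).le) (expect_mono fun h hh => (hFG h hh).ge)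

lemma expect_add {n : ℕ} {F G : History n → ℝ≥0∞} (hF : Measurable F) :
    expect n (fun h => F h + G h) = expect n F + expect n G := by
  induction n with
  | zero => rfl
  | succ n ih =>
    rw [expect_succ, expect_succ, expect_succ, ← ih (measurable_stepIntegral hF)]
    congr 1
    ext h
    simp only [stepIntegral]
    rw [← Finset.sum_add_distrib]
    refine Finset.sum_congr rfl fun i _ => ?_
    refine lintegral_add_left (hF.comp ?_) _
    exact (measurable_push i).comp (measurable_const.prodMk measurable_id)

/-! ### Ordered times, rank sequences and Fubini -/

/-- Ordered arrival times in the unit interval. -/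
def simplexSet (n : ℕ) : Set (Fin n → ℝ) := {t | StrictMono t ∧ ∀ i, t i ∈ Set.Ioc (0 : ℝ) 1}

lemma measurableSet_simplexSet (n : ℕ) : MeasurableSet (simplexSet n) := by
  have : simplexSet n = (⋂ i, ⋂ j, {t | i < j → t i < t j}) ∩ ⋂ i, {t | t i ∈ Set.Ioc (0 : ℝ) 1} := by
    ext t
    simp [simplexSet, StrictMono]
  rw [this]
  refine .inter (.iInter fun i => .iInter fun j => ?_) (.iInter fun i => ?_)
  · by_cases hij : i < j
    · simpa [hij] using measurableSet_lt (measurable_pi_apply i) (measurable_pi_apply j)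
    · simp [hij]
  · exact measurable_pi_apply i measurableSet_Ioc

lemma snoc_mem_simplexSet {n : ℕ} (t : Fin n → ℝ) (x : ℝ) :
    (Fin.snoc t x : Fin (n + 1) → ℝ) ∈ simplexSet (n + 1) ↔
      t ∈ simplexSet n ∧ x ∈ Set.Ioc (lastTime t) 1 := by
  constructor
  · rintro ⟨h1, h2⟩
    refine ⟨⟨fun i j hij => ?_, fun i => ?_⟩, ?_, ?_⟩
    · simpa using h1 (Fin.castSucc_lt_castSucc_iff.2 hij)
    · simpa using h2 i.castSucc
    · cases n with
      | zero => simpa only [lastTime_zero, Fin.snoc_last] using (h2 (Fin.last 0)).1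
      | succ n => simpa using h1 (Fin.castSucc_lt_last (Fin.last n))
    · simpa using (h2 (Fin.last n)).2
  · rintro ⟨⟨h1, h2⟩, h3, h4⟩
    have hlt : ∀ i, t i < x := by
      intro i
      cases n with
      | zero => exact i.elim0
      | succ n =>
        rw [lastTime_succ] at h3
        exact (h1.monotone (Fin.le_last i)).trans_lt h3
    have hpos : 0 < x := by
      cases n with
      | zero => simpa using h3
      | succ n => exact (h2 0).1.trans (hlt 0)
    constructor
    · intro i j
      refine Fin.lastCases ?_ (fun j => ?_) j
      · refine Fin.lastCases (by simp) (fun i _ => by simpa using hlt i) i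
      · refine Fin.lastCases (fun hi => ?_) (fun i hij => ?_) i
        · exact absurd hi (Fin.le_last _).not_gt
        · simpa using h1 (Fin.castSucc_lt_castSucc_iff.1 hij)
    · intro i
      refine Fin.lastCases (by simpa using ⟨hpos, h4⟩) (fun i => by simpa using h2 i) i

/-- The possible sequences of relative ranks. -/
def rankSeqs (n : ℕ) : Finset (Fin n → ℕ) := Fintype.piFinset fun k => Finset.Icc 1 (k.val + 1)

lemma sum_rankSeqs_succ {n : ℕ} (g : (Fin (n + 1) → ℕ) → ℝ≥0∞) :
    ∑ r ∈ rankSeqs (n + 1), g r =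
      ∑ r ∈ rankSeqs n, ∑ i ∈ Finset.Icc 1 (n + 1), g (Fin.snoc r i) := by
  rw [← Finset.sum_product']
  refine Finset.sum_bij' (fun r _ => (Fin.init r, r (Fin.last n))) (fun q _ => Fin.snoc q.1 q.2)
    ?_ ?_ ?_ ?_ ?_
  · intro r hr
    simp only [rankSeqs, Fintype.mem_piFinset, Finset.mem_product] at hr ⊢
    exact ⟨fun i => hr i.castSucc, hr (Fin.last n)⟩
  · rintro ⟨r, i⟩ hr
    simp only [rankSeqs, Fintype.mem_piFinset, Finset.mem_product] at hr ⊢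
    intro j
    refine Fin.lastCases (by simpa using hr.2) (fun j => by simpa using hr.1 j) j
  · intro r _; exact Fin.snoc_init_self r
  · rintro ⟨r, i⟩ _; simp
  · intro r _; simp

/-- Fubini: the fibre of the simplex over the earlier times is the interval from the last of them to
`1`, so the last coordinate can be integrated first. -/
lemma sum_lintegral_simplexSet_eq_expect {n : ℕ} {F : History n → ℝ≥0∞} (hF : Measurable F) :
    ∑ r ∈ rankSeqs n, ∫⁻ t in simplexSet n, F (t, r) = expect n F := by
  induction n with
  | zero =>
    have h1 : rankSeqs 0 = {Fin.elim0} := by ext r; simp [rankSeqs, eq_iff_true_of_subsingleton]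
    have h2 : simplexSet 0 = Set.univ := by
      ext t; simp [simplexSet, Subsingleton.strictMono]
    rw [h1, h2, Finset.sum_singleton, setLIntegral_univ, volume_pi, Measure.pi_of_empty _ Fin.elim0,
      lintegral_dirac]
    rfl
  | succ n ih =>
    rw [expect_succ, ← ih (measurable_stepIntegral hF), sum_rankSeqs_succ]
    refine Finset.sum_congr rfl fun r _ => ?_
    have hpush : ∀ i, Measurable fun q : (Fin n → ℝ) × ℝ => F (History.push (q.1, r) q.2 i) := by
      intro i
      exact (hF.comp (measurable_push i)).comp
        ((measurable_fst.prodMk measurable_const).prodMk measurable_snd)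
    have hs : MeasurableSet {q : (Fin n → ℝ) × ℝ | q.2 ∈ Set.Ioc (lastTime q.1) 1} :=
      (measurableSet_lt (measurable_lastTime.comp measurable_fst)
        measurable_snd).inter (measurableSet_le measurable_snd measurable_const)
    simp only [stepIntegral]
    rw [lintegral_finsetSum]
    swap
    · intro i _
      have := ((hpush i).indicator hs).lintegral_prod_right' (ν := volume)
      refine (congrArg Measurable (funext fun t => ?_)).mp this
      rw [← lintegral_indicator measurableSet_Ioc]
      rfl
    refine Finset.sum_congr rfl fun i _ => ?_
    -- Splitting off the last coordinate; inserting it again is `Fin.snoc`, that is, `History.push`.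
    rw [← (volume_preserving_piFinSuccAbove (fun _ : Fin (n + 1) => ℝ) (Fin.last n)).symm
      |>.setLIntegral_comp_preimage_emb (MeasurableEquiv.measurableEmbedding _)]
    rw [← lintegral_indicator ((MeasurableEquiv.measurable _) (measurableSet_simplexSet _)),
      Measure.volume_eq_prod, lintegral_prod_symm, ← lintegral_indicator (measurableSet_simplexSet n)]
    · refine lintegral_congr fun t => ?_
      by_cases ht : t ∈ simplexSet n
      · rw [Set.indicator_of_mem ht, ← lintegral_indicator measurableSet_Ioc]
        refine lintegral_congr fun x => ?_
        by_cases hx : x ∈ Set.Ioc (lastTime t) 1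
        · rw [Set.indicator_of_mem hx, Set.indicator_of_mem]
          · simp [History.push, MeasurableEquiv.piFinSuccAbove, Fin.insertNthEquiv]
          · simpa [MeasurableEquiv.piFinSuccAbove, Fin.insertNthEquiv] using
              (snoc_mem_simplexSet t x).2 ⟨ht, hx⟩
        · rw [Set.indicator_of_notMem hx, Set.indicator_of_notMem]
          intro h
          refine hx ((snoc_mem_simplexSet t x).1 ?_).2
          simpa [MeasurableEquiv.piFinSuccAbove, Fin.insertNthEquiv] using h
      · rw [Set.indicator_of_notMem ht]
        refine (lintegral_congr fun x => ?_).trans lintegral_zero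
        rw [Set.indicator_of_notMem]
        intro h
        refine ht ((snoc_mem_simplexSet t x).1 ?_).1
        simpa [MeasurableEquiv.piFinSuccAbove, Fin.insertNthEquiv] using h
    · refine (Measurable.indicator ?_
        ((MeasurableEquiv.measurable _) (measurableSet_simplexSet _))).aemeasurable
      exact (hF.comp (measurable_id.prodMk measurable_const)).comp (MeasurableEquiv.measurable _)

/-! ### Permutations are coded by their relative ranks -/

/-- The relative ranks of the items `σ 0, …, σ (n - 1)` arriving in this order. -/
def rankCode {n : ℕ} (σ : Equiv.Perm (Fin n)) (k : Fin n) : ℕ :=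
  (Finset.univ.filter fun j : Fin n => j ≤ k ∧ σ j ≤ σ k).card

lemma rankCode_mem_rankSeqs {n : ℕ} (σ : Equiv.Perm (Fin n)) : rankCode σ ∈ rankSeqs n := by
  rw [rankSeqs, Fintype.mem_piFinset]
  intro k
  rw [Finset.mem_Icc]
  constructor
  · exact Finset.card_pos.2 ⟨k, by simp⟩
  · calc rankCode σ k ≤ (Finset.Iic k).card :=
          Finset.card_le_card fun j hj => by simpa using (Finset.mem_filter.1 hj).2.1
      _ = k.val + 1 := Fin.card_Iic k

lemma rankCode_eq_succ {n : ℕ} (σ : Equiv.Perm (Fin n)) (k : Fin n) :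
    rankCode σ k = (Finset.univ.filter fun j : Fin n => j < k ∧ σ j < σ k).card + 1 := by
  rw [rankCode, ← Finset.card_insert_of_notMem (a := k) (by simp)]
  congr 1
  ext j
  simp only [Finset.mem_filter, Finset.mem_univ, true_and, Finset.mem_insert]
  constructor
  · rintro ⟨h1, h2⟩
    rcases h1.eq_or_lt with rfl | h
    · exact .inl rfl
    · exact .inr ⟨h, lt_of_le_of_ne h2 fun e => h.ne (σ.injective e)⟩
  · rintro (rfl | ⟨h1, h2⟩)
    · exact ⟨le_rfl, le_rfl⟩
    · exact ⟨h1.le, h2.le⟩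

/-- By induction both permutations order the entries before `k` alike. The earlier entries lying
below entry `k` form an initial segment of that common order, so the two such sets are nested; the
rank at `k` gives them equal size. -/
lemma lt_iff_lt_of_rankCode_eq {n : ℕ} {σ σ' : Equiv.Perm (Fin n)}
    (h : rankCode σ = rankCode σ') (k : Fin n) : ∀ j < k, (σ j < σ k ↔ σ' j < σ' k) := by
  induction k using WellFoundedLT.induction with
  | ind k ih =>
    have hcmp : ∀ a < k, ∀ b < k, σ a < σ b → σ' a < σ' b := by
      intro a ha b hb hab
      rcases lt_trichotomy a b with hlt | rfl | hlt
      · exact (ih b hb a hlt).1 hab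
      · exact absurd hab (lt_irrefl _)
      · by_contra hcon
        have h1 : σ' b < σ' a :=
          lt_of_le_of_ne (not_lt.1 hcon) fun e => hlt.ne (σ'.injective e)
        exact lt_asymm hab ((ih a ha b hlt).2 h1)
    set A := Finset.univ.filter fun j : Fin n => j < k ∧ σ j < σ k with hA
    set A' := Finset.univ.filter fun j : Fin n => j < k ∧ σ' j < σ' k with hA'
    have hcard : A.card = A'.card := by
      have := congrFun h k
      rw [rankCode_eq_succ, rankCode_eq_succ] at this
      exact Nat.succ.inj this
    have hsub : A ⊆ A' ∨ A' ⊆ A := by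
      by_contra! hcon
      obtain ⟨a, ha, ha'⟩ := Finset.not_subset.1 hcon.1
      obtain ⟨b, hb, hb'⟩ := Finset.not_subset.1 hcon.2
      simp only [hA, hA', Finset.mem_filter, Finset.mem_univ, true_and, not_and, not_lt] at ha ha' hb hb'
      have h1 : σ a < σ b := ha.2.trans_le (hb' hb.1)
      exact (hcmp a ha.1 b hb.1 h1).not_ge (hb.2.le.trans (ha' ha.1))
    have hAA : A = A' := by
      rcases hsub with hs | hs
      · exact Finset.eq_of_subset_of_card_le hs hcard.ge
      · exact (Finset.eq_of_subset_of_card_le hs hcard.le).symm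
    intro j hj
    have := congrArg (j ∈ ·) hAA
    simpa [hA, hA', hj] using this

lemma sort_eq_of_strictMono {n : ℕ} {u : Fin n → ℝ} {σ : Equiv.Perm (Fin n)}
    (h : StrictMono (u ∘ σ)) : Tuple.sort u = σ := by
  symm
  rw [Tuple.eq_sort_iff]
  exact ⟨h.monotone, fun i j hij he => absurd he (h hij).ne⟩

lemma rankCode_injective (n : ℕ) :
    Function.Injective (rankCode : Equiv.Perm (Fin n) → Fin n → ℕ) := by
  intro σ σ' h
  have hlt : ∀ i j, σ i < σ j → σ' i < σ' j := by
    intro a b hab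
    rcases lt_trichotomy a b with hlt | rfl | hlt
    · exact (lt_iff_lt_of_rankCode_eq h b a hlt).1 hab
    · exact absurd hab (lt_irrefl _)
    · by_contra hcon
      have h1 : σ' b < σ' a :=
        lt_of_le_of_ne (not_lt.1 hcon) fun e => hlt.ne (σ'.injective e)
      exact lt_asymm hab ((lt_iff_lt_of_rankCode_eq h a b hlt).2 h1)
  have hmono : StrictMono (σ' ∘ σ.symm) := fun i j hij => hlt _ _ (by simpa using hij)
  -- A strictly increasing permutation is the identity, because both of them sort the increasing
  -- sequence `0, 1, …` and the sorting permutation is unique.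
  have hid : σ' ∘ σ.symm = id := by
    have := sort_eq_of_strictMono (u := fun i : Fin n => (i : ℝ)) (σ := σ.symm.trans σ')
      fun i j hij => by simpa using hmono hij
    have h2 := sort_eq_of_strictMono (u := fun i : Fin n => (i : ℝ)) (σ := Equiv.refl _)
      fun i j hij => by simpa using hij
    exact congrArg DFunLike.coe (this.symm.trans h2)
  ext i
  have := congrFun hid (σ i)
  simp at this
  rw [this]

/-- The code is injective, and there are `n!` permutations and `1 * 2 * ⋯ * n` rank sequences, so it
is a bijection. -/
lemma sum_rankCode {n : ℕ} (g : (Fin n → ℕ) → ℝ≥0∞) :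
    ∑ σ : Equiv.Perm (Fin n), g (rankCode σ) = ∑ r ∈ rankSeqs n, g r := by
  have himg : Finset.univ.image (rankCode : Equiv.Perm (Fin n) → Fin n → ℕ) = rankSeqs n := by
    refine Finset.eq_of_subset_of_card_le ?_ ?_
    · intro r hr
      obtain ⟨σ, -, rfl⟩ := Finset.mem_image.1 hr
      exact rankCode_mem_rankSeqs σ
    · rw [Finset.card_image_of_injective _ (rankCode_injective n), Finset.card_univ,
        Fintype.card_perm, Fintype.card_fin, rankSeqs, Fintype.card_piFinset]
      simp only [Nat.card_Icc, Nat.add_sub_cancel]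
      rw [Fin.prod_univ_eq_prod_range (fun k => k + 1) n, Finset.prod_range_add_one_eq_factorial]
  rw [← himg, Finset.sum_image fun a _ b _ hab => rankCode_injective n hab]

/-! ### From independent uniform times to the iterated integral -/

lemma volume_setOf_eq_eq_zero {n : ℕ} {i j : Fin n} (hij : i ≠ j) :
    volume {u : Fin n → ℝ | u i = u j} = 0 := by
  let f : (Fin n → ℝ) →ₗ[ℝ] ℝ := (LinearMap.proj i : (Fin n → ℝ) →ₗ[ℝ] ℝ) - LinearMap.proj j
  have hne : LinearMap.ker f ≠ ⊤ := by
    intro h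
    have : f (Pi.single i 1) = 0 := by
      rw [LinearMap.ker_eq_top] at h; rw [h]; rfl
    simp [f, hij.symm] at this
  have := Measure.addHaar_submodule volume (LinearMap.ker f) hne
  convert this using 2
  ext u
  simp [f, sub_eq_zero]

lemma volume_setOf_eq_zero_eq_zero {n : ℕ} (i : Fin n) :
    volume {u : Fin n → ℝ | u i = 0} = 0 := by
  let f : (Fin n → ℝ) →ₗ[ℝ] ℝ := LinearMap.proj i
  have hne : LinearMap.ker f ≠ ⊤ := by
    intro h
    have : f (Pi.single i 1) = 0 := by
      rw [LinearMap.ker_eq_top] at h; rw [h]; rfl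
    simp [f] at this
  have := Measure.addHaar_submodule volume (LinearMap.ker f) hne
  convert this using 2
  ext u
  simp [f]

/-- Up to ties and zero coordinates the cube is the disjoint union of `n!` copies of the simplex,
one for each arrival order `σ`, and permuting coordinates preserves volume. Items are labelled by
their ranks, so the order of arrival determines the relative ranks. -/
lemma arrivalLaw_eq_sum {n : ℕ} {S : Set (History n)} (hS : MeasurableSet S) :
    arrivalLaw n {u | (orderedTimes u, relRank u) ∈ S} =
      ∑ σ : Equiv.Perm (Fin n), volume (simplexSet n ∩ {t | (t, rankCode σ) ∈ S}) := by
  have hT : ∀ σ : Equiv.Perm (Fin n),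
      MeasurableSet (simplexSet n ∩ {t | (t, rankCode σ) ∈ S}) := fun σ =>
    (measurableSet_simplexSet n).inter ((measurable_id.prodMk measurable_const) hS)
  have hmp : ∀ σ : Equiv.Perm (Fin n),
      MeasurePreserving (fun u : Fin n → ℝ => u ∘ σ) volume volume := by
    intro σ
    exact (volume_measurePreserving_piCongrLeft (fun _ : Fin n => ℝ) σ).symm
  have hlaw : arrivalLaw n = volume.restrict (Set.univ.pi fun _ => Set.Icc (0 : ℝ) 1) := by
    rw [arrivalLaw, volume_pi, Measure.restrict_pi_pi]
  set E : Equiv.Perm (Fin n) → Set (Fin n → ℝ) := fun σ =>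
    (fun u : Fin n → ℝ => u ∘ σ) ⁻¹' (simplexSet n ∩ {t | (t, rankCode σ) ∈ S}) with hE
  have hdisj : Pairwise (Function.onFun Disjoint E) := by
    intro σ σ' hne
    refine Set.disjoint_left.2 fun u hu hu' => hne ?_
    rw [← sort_eq_of_strictMono hu.1.1, ← sort_eq_of_strictMono hu'.1.1]
  have hae : ∀ᵐ u ∂(volume : Measure (Fin n → ℝ)),
      (∀ i j, i ≠ j → u i ≠ u j) ∧ ∀ i, u i ≠ 0 := by
    refine Filter.Eventually.and ?_ ?_
    · refine ae_all_iff.2 fun i => ae_all_iff.2 fun j => ?_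
      by_cases hij : i = j
      · simp [hij]
      · have := volume_setOf_eq_eq_zero hij
        simpa [ae_iff, hij] using this
    · refine ae_all_iff.2 fun i => ?_
      simpa [ae_iff] using volume_setOf_eq_zero_eq_zero i
  have hset : (({u | (orderedTimes u, relRank u) ∈ S} ∩ Set.univ.pi fun _ => Set.Icc (0 : ℝ) 1 :
      Set (Fin n → ℝ))) =ᵐ[volume] (⋃ σ, E σ : Set (Fin n → ℝ)) := by
    filter_upwards [hae] with u hu
    refine propext ⟨?_, ?_⟩
    · rintro ⟨h1, h2⟩
      refine Set.mem_iUnion.2 ⟨Tuple.sort u, ⟨?_, fun i => ?_⟩, h1⟩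
      · have hinj : Function.Injective u := fun i j hij =>
          by_contra fun hne => hu.1 _ _ hne hij
        exact (Tuple.monotone_sort u).strictMono_of_injective
          (hinj.comp (Tuple.sort u).injective)
      · exact ⟨lt_of_le_of_ne (h2 _ trivial).1 (hu.2 _).symm, (h2 _ trivial).2⟩
    · intro h
      obtain ⟨σ, hσ, hσS⟩ := Set.mem_iUnion.1 h
      have hs := sort_eq_of_strictMono hσ.1
      refine ⟨?_, fun i _ => ?_⟩
      · have e1 : orderedTimes u = u ∘ σ := by funext k; simp [orderedTimes, hs]
        have e2 : relRank u = rankCode σ := by funext k; simp [relRank, rankCode, hs]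
        change (orderedTimes u, relRank u) ∈ S
        rw [e1, e2]
        exact hσS
      · have := hσ.2 (σ.symm i)
        simp only [Function.comp, Equiv.apply_symm_apply] at this
        exact ⟨this.1.le, this.2⟩
  rw [hlaw, Measure.restrict_apply' (MeasurableSet.univ_pi fun _ => measurableSet_Icc),
    measure_congr hset, measure_iUnion hdisj fun σ => (hmp σ).measurable (hT σ), tsum_fintype]
  exact Finset.sum_congr rfl fun σ _ => (hmp σ).measure_preimage (hT σ).nullMeasurableSet

theorem arrivalLaw_eq_expect {n : ℕ} {S : Set (History n)} (hS : MeasurableSet S) :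
    arrivalLaw n {u | (orderedTimes u, relRank u) ∈ S} = expect n (S.indicator 1) := by
  rw [arrivalLaw_eq_sum hS,
    sum_rankCode fun r => volume (simplexSet n ∩ {t | (t, r) ∈ S}),
    ← sum_lintegral_simplexSet_eq_expect (measurable_one.indicator hS)]
  refine Finset.sum_congr rfl fun r _ => ?_
  have hr : MeasurableSet {t : Fin n → ℝ | (t, r) ∈ S} :=
    (measurable_id.prodMk measurable_const) hS
  have : (fun t => S.indicator (1 : History n → ℝ≥0∞) (t, r)) =
      {t : Fin n → ℝ | (t, r) ∈ S}.indicator 1 := rfl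
  rw [this, lintegral_indicator_one hr, Measure.restrict_apply hr, Set.inter_comm]

/-! ### Waiting, stopping and winning, one arrival at a time -/

namespace Strategy

variable (τ : Strategy)

/-- The histories at which no arrival has been accepted. -/
def waitSet (n : ℕ) : Set (History n) := {h | ∀ k, ¬ τ.Accepts h.1 h.2 k}

/-- The histories at which the last arrival is the one Alice stops at. -/
def stopSet (n : ℕ) : Set (History (n + 1)) := {h | τ.StopsAt h.1 h.2 (Fin.last n)}

/-- The histories at which Alice has stopped, at the best item so far. -/
def winSet (n : ℕ) : Set (History n) := {h | τ.Wins h.1 h.2}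

lemma accepts_push_castSucc {n : ℕ} (h : History n) (x : ℝ) (i : ℕ) (k : Fin n) :
    τ.Accepts (h.push x i).1 (h.push x i).2 k.castSucc ↔ τ.Accepts h.1 h.2 k := by
  have h1 : prefixTo (h.push x i).1 k.castSucc = prefixTo h.1 k := funext fun j =>
    Fin.snoc_castSucc (α := fun _ => ℝ) x h.1 (Fin.castLE k.isLt j)
  have h2 : prefixTo (h.push x i).2 k.castSucc = prefixTo h.2 k := funext fun j =>
    Fin.snoc_castSucc (α := fun _ => ℕ) i h.2 (Fin.castLE k.isLt j)
  simp only [Accepts, h1, h2]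
  rfl

lemma accepts_last {n : ℕ} (h : History (n + 1)) :
    τ.Accepts h.1 h.2 (Fin.last n) ↔ h ∈ τ.accept n := Iff.rfl

lemma push_mem_waitSet {n : ℕ} (h : History n) (x : ℝ) (i : ℕ) :
    h.push x i ∈ τ.waitSet (n + 1) ↔ h ∈ τ.waitSet n ∧ h.push x i ∉ τ.accept n := by
  simp only [waitSet, Set.mem_ofPred_eq, Fin.forall_fin_succ', accepts_push_castSucc, accepts_last]

lemma push_mem_stopSet {n : ℕ} (h : History n) (x : ℝ) (i : ℕ) :
    h.push x i ∈ τ.stopSet n ↔ h ∈ τ.waitSet n ∧ h.push x i ∈ τ.accept n := by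
  simp only [waitSet, stopSet, StopsAt, Set.mem_ofPred_eq, Fin.forall_fin_succ',
    accepts_push_castSucc, accepts_last, Fin.castSucc_lt_last, lt_self_iff_false, forall_const,
    IsEmpty.forall_iff, true_and, and_comm]

lemma stopsAt_push_castSucc {n : ℕ} (h : History n) (x : ℝ) (i : ℕ) (k : Fin n) :
    τ.StopsAt (h.push x i).1 (h.push x i).2 k.castSucc ↔ τ.StopsAt h.1 h.2 k := by
  simp only [StopsAt, Fin.forall_fin_succ', accepts_push_castSucc, Fin.castSucc_lt_castSucc_iff,
    (Fin.castSucc_lt_last k).not_gt, IsEmpty.forall_iff, and_true]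

/-- An accepted arrival is a record, so stopping now means holding the best item so far; an earlier
choice stays the best exactly if the new arrival is no record. -/
lemma push_mem_winSet {n : ℕ} (h : History n) (x : ℝ) (i : ℕ) :
    h.push x i ∈ τ.winSet (n + 1) ↔ h.push x i ∈ τ.stopSet n ∨ (h ∈ τ.winSet n ∧ i ≠ 1) := by
  simp only [winSet, Wins, Set.mem_ofPred_eq, Fin.exists_fin_succ']
  rw [or_comm]
  refine or_congr ?_ ?_
  · refine ⟨fun H => H.1, fun H => ⟨H, τ.record_of_mem n _ H.1, fun j hj => ?_⟩⟩
    exact absurd hj (Fin.le_last j).not_gt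
  · simp only [stopsAt_push_castSucc, Fin.forall_fin_succ', Fin.castSucc_lt_castSucc_iff,
      Fin.castSucc_lt_last, forall_const]
    simp only [History.push, Fin.snoc_castSucc, Fin.snoc_last]
    constructor
    · rintro ⟨k, h1, h2, h3, h4⟩; exact ⟨⟨k, h1, h2, h3⟩, h4⟩
    · rintro ⟨⟨k, h1, h2, h3⟩, h4⟩; exact ⟨k, h1, h2, h3, h4⟩

lemma disjoint_waitSet_winSet (n : ℕ) : Disjoint (τ.waitSet n) (τ.winSet n) :=
  Set.disjoint_left.2 fun _ h1 ⟨k, h2, _⟩ => h1 k h2.1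

/-- The two ways to be winning exclude each other, since stopping now requires having waited so far.
-/
lemma indicator_winSet_push {n : ℕ} (h : History n) (x : ℝ) (i : ℕ)
    (g : History (n + 1) → ℝ≥0∞) :
    (τ.winSet (n + 1)).indicator g (h.push x i) = (τ.stopSet n).indicator g (h.push x i) +
      (τ.winSet n).indicator (fun _ => if i = 1 then 0 else g (h.push x i)) h := by
  have hw := τ.push_mem_winSet h x i
  by_cases h1 : h.push x i ∈ τ.stopSet n
  · have h2 : h ∉ τ.winSet n := Set.disjoint_left.1 (τ.disjoint_waitSet_winSet _)
      ((τ.push_mem_stopSet h x i).1 h1).1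
    rw [Set.indicator_of_mem (hw.2 (.inl h1)), Set.indicator_of_mem h1,
      Set.indicator_of_notMem h2, add_zero]
  · rw [Set.indicator_of_notMem h1, zero_add]
    by_cases h2 : h ∈ τ.winSet n
    · rw [Set.indicator_of_mem h2]
      split_ifs with h3
      · exact Set.indicator_of_notMem (fun H => (hw.1 H).elim h1 fun H => H.2 h3) _
      · exact Set.indicator_of_mem (hw.2 (.inr ⟨h2, h3⟩)) _
    · rw [Set.indicator_of_notMem h2]
      exact Set.indicator_of_notMem (fun H => (hw.1 H).elim h1 fun H => h2 H.1) _

open Classical in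
lemma indicator_stopSet_add_waitSet_push {n : ℕ} (h : History n) (x : ℝ) (i : ℕ)
    (f g : History (n + 1) → ℝ≥0∞) :
    (τ.stopSet n).indicator f (h.push x i) + (τ.waitSet (n + 1)).indicator g (h.push x i) =
      (τ.waitSet n).indicator (fun _ =>
        if h.push x i ∈ τ.accept n then f (h.push x i) else g (h.push x i)) h := by
  have hs := τ.push_mem_stopSet h x i
  have hw := τ.push_mem_waitSet h x i
  by_cases h1 : h ∈ τ.waitSet n
  · rw [Set.indicator_of_mem h1]
    split_ifs with h2
    · rw [Set.indicator_of_mem (hs.2 ⟨h1, h2⟩), Set.indicator_of_notMem fun H => (hw.1 H).2 h2,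
        add_zero]
    · rw [Set.indicator_of_mem (hw.2 ⟨h1, h2⟩), Set.indicator_of_notMem fun H => h2 (hs.1 H).2,
        zero_add]
  · rw [Set.indicator_of_notMem h1, Set.indicator_of_notMem fun H => h1 (hs.1 H).1,
      Set.indicator_of_notMem fun H => h1 (hw.1 H).1, add_zero]

lemma measurableSet_accepts {n : ℕ} (k : Fin n) :
    MeasurableSet {h : History n | τ.Accepts h.1 h.2 k} := by
  have : Measurable fun h : History n => (prefixTo h.1 k, prefixTo h.2 k) := by
    refine Measurable.prodMk (measurable_pi_iff.2 fun j => ?_) (measurable_pi_iff.2 fun j => ?_)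
    · exact (measurable_pi_apply _).comp measurable_fst
    · exact (measurable_pi_apply _).comp measurable_snd
  exact this (τ.measurableSet_accept k)

lemma measurableSet_stopsAt {n : ℕ} (k : Fin n) :
    MeasurableSet {h : History n | τ.StopsAt h.1 h.2 k} := by
  have : {h : History n | τ.StopsAt h.1 h.2 k} = {h : History n | τ.Accepts h.1 h.2 k} ∩
      ⋂ j, {h : History n | j < k → ¬ τ.Accepts h.1 h.2 j} := by
    ext h; simp [StopsAt]
  rw [this]
  refine (τ.measurableSet_accepts k).inter (.iInter fun j => ?_)
  by_cases hj : j < k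
  · have e : {h : History n | j < k → ¬ τ.Accepts h.1 h.2 j} =
        {h : History n | τ.Accepts h.1 h.2 j}ᶜ := by ext h; simp [hj]
    rw [e]
    exact (τ.measurableSet_accepts j).compl
  · simp [hj]

lemma measurableSet_stopSet (n : ℕ) : MeasurableSet (τ.stopSet n) := τ.measurableSet_stopsAt _

lemma measurableSet_winSet (n : ℕ) : MeasurableSet (τ.winSet n) := by
  have : τ.winSet n = ⋃ k, ({h : History n | τ.StopsAt h.1 h.2 k} ∩
      ({h : History n | h.2 k = 1} ∩ ⋂ j, {h : History n | k < j → h.2 j ≠ 1})) := by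
    ext h; simp [winSet, Wins]
  rw [this]
  have hm : ∀ k, MeasurableSet {h : History n | h.2 k = 1} := fun k =>
    ((measurable_pi_apply k).comp measurable_snd) (measurableSet_singleton 1)
  refine .iUnion fun k => (τ.measurableSet_stopsAt k).inter ((hm k).inter (.iInter fun j => ?_))
  by_cases hj : k < j
  · have e : {h : History n | k < j → h.2 j ≠ 1} = {h : History n | h.2 j = 1}ᶜ := by
      ext h; simp [hj]
    rw [e]
    exact (hm j).compl
  · simp [hj]

end Strategy

/-! ### The winning probability as a sum of stopping weights -/

lemma sum_Icc_ite_one (n : ℕ) (a b : ℝ≥0∞) :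
    ∑ i ∈ Finset.Icc 1 (n + 1), (if i = 1 then a else b) = a + n * b := by
  rw [← Finset.add_sum_Ioc_eq_sum_Icc (by omega), if_pos rfl, Finset.sum_congr rfl
    (g := fun _ => b), Finset.sum_const, Nat.card_Ioc, nsmul_eq_mul, Nat.add_sub_cancel]
  intro i hi
  rw [if_neg (Finset.mem_Ioc.1 hi).1.ne']

/-- Integration of a function that depends on the past through membership in `A`, and on the
last arrival through its time and whether it is a record. -/
lemma expect_succ_of_push {n : ℕ} {A : Set (History n)} {V U : ℝ → ℝ≥0∞}
    {F : History (n + 1) → ℝ≥0∞}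
    (hF : ∀ (h : History n), ∀ x ∈ Set.Icc (0 : ℝ) 1, ∀ i : ℕ, F (h.push x i) =
      A.indicator (fun _ => if i = 1 then V x else U x) h) :
    expect (n + 1) F = expect n (A.indicator fun h =>
      (∫⁻ x in Set.Ioc (lastTime h.1) 1, V x) + n * ∫⁻ x in Set.Ioc (lastTime h.1) 1, U x) := by
  rw [expect_succ]
  refine expect_congr fun h hh => ?_
  have hstep : stepIntegral F h = ∑ i ∈ Finset.Icc 1 (n + 1), ∫⁻ x in Set.Ioc (lastTime h.1) 1,
      A.indicator (fun _ => if i = 1 then V x else U x) h := by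
    refine Finset.sum_congr rfl fun i _ => setLIntegral_congr_fun measurableSet_Ioc fun x hx => ?_
    exact hF h x ⟨hh.1.trans hx.1.le, hx.2⟩ i
  rw [hstep]
  by_cases hA : h ∈ A
  · simp only [Set.indicator_of_mem hA]
    rw [← sum_Icc_ite_one]
    refine Finset.sum_congr rfl fun i _ => ?_
    split_ifs <;> rfl
  · simp [Set.indicator_of_notMem hA]

/-- The winning weight of stopping at the record of index `k + 1` when `y` is the time left and
there are `n` items. -/
noncomputable def stopWeight (n k : ℕ) (y : ℝ) : ℝ := ((n - 1).choose k) * y ^ (n - 1 - k)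

lemma stopWeight_nonneg (n k : ℕ) {y : ℝ} (hy : 0 ≤ y) : 0 ≤ stopWeight n k y := by
  unfold stopWeight; positivity

lemma continuous_stopWeight (n k : ℕ) : Continuous (stopWeight n k) := by
  unfold stopWeight; fun_prop

lemma lintegral_Ioc_one_sub {f : ℝ → ℝ} {t u : ℝ} (htu : t ≤ u)
    (hf : IntervalIntegrable f volume (1 - u) (1 - t))
    (h0 : ∀ y ∈ Set.Ico (1 - u) (1 - t), 0 ≤ f y) :
    ∫⁻ x in Set.Ioc t u, ENNReal.ofReal (f (1 - x)) =
      ENNReal.ofReal (∫ y in (1 - u)..(1 - t), f y) := by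
  have hi : IntervalIntegrable (fun x => f (1 - x)) volume t u := by
    simpa using (hf.comp_sub_left 1).symm
  rw [← intervalIntegral.integral_comp_sub_left (fun y => f y) 1,
    intervalIntegral.integral_of_le htu, ofReal_integral_eq_lintegral_ofReal]
  · exact (intervalIntegrable_iff_integrableOn_Ioc_of_le htu).1 hi
  · filter_upwards [ae_restrict_mem measurableSet_Ioc] with x hx
    exact h0 _ ⟨by linarith [hx.2], by linarith [hx.1]⟩

/-- Consistency of the weights: a chosen best item survives the next arrival through `k + 1`
non-record ranks. This makes the winning weight invariant when one more arrival is observed. -/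
lemma mul_integral_stopWeight {n k : ℕ} (hk : k + 1 < n) (y : ℝ) :
    ((k + 1 : ℕ) : ℝ) * ∫ z in (0 : ℝ)..y, stopWeight n (k + 1) z = stopWeight n k y := by
  obtain ⟨m, rfl⟩ : ∃ m, n = m + k + 2 := ⟨n - (k + 2), by omega⟩
  have h1 : m + k + 2 - 1 = m + k + 1 := rfl
  have h2 : m + k + 1 - (k + 1) = m := by omega
  have h3 : m + k + 1 - k = m + 1 := by omega
  simp only [stopWeight, h1, h2, h3]
  rw [intervalIntegral.integral_const_mul, integral_pow]
  -- The factor `m + 1` cancels the denominator produced by integrating `z ^ m`.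
  have hc : ((m + k + 1).choose (k + 1) : ℝ) * ((k + 1 : ℕ) : ℝ) =
      ((m + k + 1).choose k : ℝ) * ((m + 1 : ℕ) : ℝ) := by
    have := Nat.choose_succ_right_eq (m + k + 1) k
    rw [h3] at this
    exact_mod_cast this
  have hm : ((m : ℝ) + 1) ≠ 0 := by positivity
  push_cast at hc ⊢
  field_simp
  simp
  linear_combination y ^ (m + 1) * hc

/-- Each further arrival adds the histories stopped just now, while those already winning keep their
weight by `mul_integral_stopWeight`. For `k = n - 1` the weight is `1`, and the left side is the
winning probability. -/
lemma expect_winSet_eq_sum (τ : Strategy) (n k : ℕ) (hk : k < n) :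
    expect (k + 1) ((τ.winSet (k + 1)).indicator fun h =>
        ENNReal.ofReal (stopWeight n k (1 - lastTime h.1))) =
      ∑ j ∈ Finset.range (k + 1), expect (j + 1) ((τ.stopSet j).indicator fun h =>
        ENNReal.ofReal (stopWeight n j (1 - lastTime h.1))) := by
  induction k with
  | zero =>
    rw [Finset.sum_range_one]
    refine congrArg (expect 1) (congrArg (fun S => Set.indicator S _) ?_)
    ext h
    constructor
    · rintro ⟨k, h1, -⟩
      rwa [Fin.fin_one_eq_zero k] at h1
    · intro h1
      exact ⟨0, h1, τ.record_of_mem 0 _ h1.1, fun j hj => absurd hj (by simp [Fin.fin_one_eq_zero j])⟩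
  | succ k ih =>
    rw [Finset.sum_range_succ, ← ih (by omega)]
    refine Eq.trans ?_ (add_comm _ _)
    set g : History (k + 2) → ℝ≥0∞ := fun h =>
      ENNReal.ofReal (stopWeight n (k + 1) (1 - lastTime h.1)) with hg
    have hgm : Measurable g := ENNReal.measurable_ofReal.comp
      ((continuous_stopWeight n (k + 1)).measurable.comp
        (measurable_const.sub (measurable_lastTime.comp measurable_fst)))
    -- The part of the winning set where the choice was made earlier and the newest arrival is no
    -- record.
    set F : History (k + 2) → ℝ≥0∞ := fun h =>
      (τ.winSet (k + 1)).indicator (fun _ => if h.2 (Fin.last _) = 1 then 0 else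
        ENNReal.ofReal (stopWeight n (k + 1) (1 - lastTime h.1))) (Fin.init h.1, Fin.init h.2) with hF
    have hsplit : (τ.winSet (k + 2)).indicator g = fun h => (τ.stopSet (k + 1)).indicator g h + F h := by
      funext h
      obtain ⟨h', x, i, rfl⟩ : ∃ (h' : History (k + 1)) (x : ℝ) (i : ℕ), h = h'.push x i :=
        ⟨(Fin.init h.1, Fin.init h.2), h.1 (Fin.last _), h.2 (Fin.last _), by simp [History.push]⟩
      have hFp : F (h'.push x i) = (τ.winSet (k + 1)).indicator (fun _ => if i = 1 then 0 else
          g (h'.push x i)) h' := by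
        simp [hF, hg, History.push]
      rw [hFp]
      exact τ.indicator_winSet_push h' x i g
    rw [hsplit, expect_add (hgm.indicator (τ.measurableSet_stopSet _))]
    congr 1
    rw [expect_succ_of_push (A := τ.winSet (k + 1)) (V := fun _ => 0)
      (U := fun x => ENNReal.ofReal (stopWeight n (k + 1) (1 - x)))]
    · refine expect_congr fun h hh => ?_
      by_cases hw : h ∈ τ.winSet (k + 1)
      · rw [Set.indicator_of_mem hw, Set.indicator_of_mem hw, lintegral_zero, zero_add,
          lintegral_Ioc_one_sub hh.2 ((continuous_stopWeight _ _).intervalIntegrable _ _)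
            fun y hy => stopWeight_nonneg _ _ (by simpa using hy.1),
          ← mul_integral_stopWeight hk, sub_self, ENNReal.ofReal_mul (by positivity),
          ENNReal.ofReal_natCast]
      · rw [Set.indicator_of_notMem hw, Set.indicator_of_notMem hw]
    · intro h x _ i
      simp [hF, History.push]

lemma expect_const_mul {n : ℕ} (c : ℝ≥0∞) {F : History n → ℝ≥0∞} (hF : Measurable F) :
    expect n (fun h => c * F h) = c * expect n F := by
  induction n with
  | zero => rfl
  | succ n ih =>
    rw [expect_succ, expect_succ, ← ih (measurable_stepIntegral hF)]
    congr 1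
    ext h
    simp only [stepIntegral, Finset.mul_sum]
    refine Finset.sum_congr rfl fun i _ => lintegral_const_mul c (hF.comp ?_)
    exact (measurable_push i).comp (measurable_const.prodMk measurable_id)

/-- The payoff of `τ` against `n` arrivals if stopping at a record of index `k + 1` with time `y`
left has weight `S k y`. -/
noncomputable def payoff (τ : Strategy) (S : ℕ → ℝ → ℝ) (n : ℕ) : ℝ≥0∞ :=
  ∑ k ∈ Finset.range n, expect (k + 1) ((τ.stopSet k).indicator fun h =>
    ENNReal.ofReal (S k (1 - lastTime h.1)))

lemma measurable_ofReal_timeLeft {n : ℕ} {f : ℝ → ℝ} (hf : Continuous f) :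
    Measurable fun h : History n => ENNReal.ofReal (f (1 - lastTime h.1)) :=
  ENNReal.measurable_ofReal.comp
    (hf.measurable.comp (measurable_const.sub (measurable_lastTime.comp measurable_fst)))

lemma arrivalLaw_wins (τ : Strategy) {n : ℕ} (hn : 0 < n) :
    arrivalLaw n {u | τ.Wins (orderedTimes u) (relRank u)} = payoff τ (stopWeight n) n := by
  obtain ⟨k, rfl⟩ : ∃ k, n = k + 1 := ⟨n - 1, by omega⟩
  have h1 := arrivalLaw_eq_expect (τ.measurableSet_winSet (k + 1))
  rw [payoff, ← expect_winSet_eq_sum τ (k + 1) k (by omega)]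
  refine h1.trans (congrArg (expect (k + 1)) ?_)
  congr 1
  ext h
  simp [stopWeight]

instance (n : ℕ) : IsProbabilityMeasure (arrivalLaw n) := by
  have : IsProbabilityMeasure (volume.restrict (Set.Icc (0 : ℝ) 1)) := ⟨by simp⟩
  unfold arrivalLaw
  infer_instance

lemma ofReal_winProb (τ : Strategy) {n : ℕ} (hn : 0 < n) :
    ENNReal.ofReal (winProb τ n) = payoff τ (stopWeight n) n := by
  rw [← arrivalLaw_wins τ hn, winProb, ofReal_measureReal]

lemma winProb_nonneg (τ : Strategy) (n : ℕ) : 0 ≤ winProb τ n := measureReal_nonneg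

/-! ### Mixtures of two numbers of items -/

/-- The stopping weights for the law with masses `1 - p` at `m` and `p` at `n`. -/
noncomputable def mixWeight (m n : ℕ) (p : ℝ) (k : ℕ) (y : ℝ) : ℝ :=
  (1 - p) * stopWeight m k y + p * stopWeight n k y

lemma continuous_mixWeight (m n : ℕ) (p : ℝ) (k : ℕ) : Continuous (mixWeight m n p k) :=
  ((continuous_stopWeight m k).const_mul _).add ((continuous_stopWeight n k).const_mul _)

/-- For `n = 0` truncated subtraction would give weight `1` at `k = 0`, hence the positivity
assumption. -/
lemma stopWeight_eq_zero {n k : ℕ} (hn : 0 < n) (hk : n ≤ k) (y : ℝ) : stopWeight n k y = 0 := by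
  rw [stopWeight, Nat.choose_eq_zero_of_lt (by omega)]
  simp

lemma expect_zero (n : ℕ) : expect n (fun _ => 0) = 0 := by
  induction n with
  | zero => rfl
  | succ n ih =>
    have : stepIntegral (fun _ : History (n + 1) => 0) = fun _ => 0 := by
      ext h
      simp [stepIntegral]
    rw [expect_succ, this, ih]

/-- Records beyond index `m` have weight zero, so both numbers of items can share the longer
horizon. -/
lemma payoff_stopWeight_of_le (τ : Strategy) {m n : ℕ} (hm : 0 < m) (hmn : m ≤ n) :
    payoff τ (stopWeight m) n = payoff τ (stopWeight m) m := by
  refine (Finset.sum_subset (Finset.range_mono hmn) fun k _ hk => ?_).symm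
  rw [← expect_zero (k + 1)]
  congr 1
  ext h
  simp [stopWeight_eq_zero hm (by simpa using hk)]

lemma payoff_mixWeight (τ : Strategy) {m n : ℕ} (hm : 0 < m) (hmn : m ≤ n)
    {p : ℝ} (hp : p ∈ Set.Icc (0 : ℝ) 1) :
    payoff τ (mixWeight m n p) n =
      ENNReal.ofReal ((1 - p) * winProb τ m + p * winProb τ n) := by
  have h0 : 0 ≤ 1 - p := sub_nonneg.2 hp.2
  rw [ENNReal.ofReal_add (mul_nonneg h0 (winProb_nonneg _ _))
    (mul_nonneg hp.1 (winProb_nonneg _ _)), ENNReal.ofReal_mul h0, ENNReal.ofReal_mul hp.1,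
    ofReal_winProb τ hm, ofReal_winProb τ (hm.trans_le hmn), ← payoff_stopWeight_of_le τ hm hmn]
  simp only [payoff, Finset.mul_sum, ← Finset.sum_add_distrib]
  refine Finset.sum_congr rfl fun k _ => ?_
  have hmeas : ∀ N : ℕ, Measurable ((τ.stopSet k).indicator fun h : History (k + 1) =>
      ENNReal.ofReal (stopWeight N k (1 - lastTime h.1))) := fun N =>
    (measurable_ofReal_timeLeft (continuous_stopWeight N k)).indicator (τ.measurableSet_stopSet k)
  rw [← expect_const_mul _ (hmeas m), ← expect_const_mul _ (hmeas n),
    ← expect_add ((hmeas m).const_mul _)]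
  refine expect_congr fun h hh => ?_
  by_cases hs : h ∈ τ.stopSet k
  · simp only [Set.indicator_of_mem hs, mixWeight]
    have hy : 0 ≤ 1 - lastTime h.1 := sub_nonneg.2 hh.2
    rw [ENNReal.ofReal_add (mul_nonneg h0 (stopWeight_nonneg _ _ hy))
      (mul_nonneg hp.1 (stopWeight_nonneg _ _ hy)), ENNReal.ofReal_mul h0, ENNReal.ofReal_mul hp.1]
  · simp [Set.indicator_of_notMem hs]

/-! ### Verification of the optimality equation -/

section Recursion

variable {n : ℕ} {S U V : ℕ → ℝ → ℝ}

/-- Before any arrival the time left is `1`, so for `k = 0` the recursion is required at `y = 1`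
only; the initial value may then be a constant. -/
lemma expect_waitSet_eq (τ : Strategy) (k : ℕ)
    (hU : Continuous (U (k + 1))) (hV : IntervalIntegrable (V k) volume 0 1)
    (hU0 : ∀ y ∈ Set.Icc (0 : ℝ) 1, 0 ≤ U (k + 1) y) (hV0 : ∀ y ∈ Set.Icc (0 : ℝ) 1, 0 ≤ V k y)
    (hrec : ∀ y ∈ Set.Icc (0 : ℝ) 1, (k = 0 → y = 1) →
      (∫ z in (0 : ℝ)..y, V k z) + k * ∫ z in (0 : ℝ)..y, U (k + 1) z = U k y) :
    expect k ((τ.waitSet k).indicator fun h =>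
      (∫⁻ x in Set.Ioc (lastTime h.1) 1, ENNReal.ofReal (V k (1 - x))) +
        k * ∫⁻ x in Set.Ioc (lastTime h.1) 1, ENNReal.ofReal (U (k + 1) (1 - x))) =
    expect k ((τ.waitSet k).indicator fun h => ENNReal.ofReal (U k (1 - lastTime h.1))) := by
  refine expect_congr fun h hh => ?_
  have hy : 1 - lastTime h.1 ∈ Set.Icc (0 : ℝ) 1 := ⟨sub_nonneg.2 hh.2, by linarith [hh.1]⟩
  have hle : ∀ y ∈ Set.Ico (1 - 1 : ℝ) (1 - lastTime h.1), y ∈ Set.Icc (0 : ℝ) 1 := fun y hy' =>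
    ⟨by simpa using hy'.1, hy'.2.le.trans hy.2⟩
  by_cases hw : h ∈ τ.waitSet k
  · rw [Set.indicator_of_mem hw, Set.indicator_of_mem hw,
      lintegral_Ioc_one_sub hh.2 (hV.mono_set ?_) fun y hy' => hV0 y (hle y hy'),
      lintegral_Ioc_one_sub hh.2 (hU.intervalIntegrable _ _) fun y hy' => hU0 y (hle y hy'),
      sub_self, ← ENNReal.ofReal_natCast, ← ENNReal.ofReal_mul (by positivity),
      ← ENNReal.ofReal_add, hrec _ hy]
    · rintro rfl
      simp
    · exact intervalIntegral.integral_nonneg hy.1 fun z hz => hV0 z ⟨hz.1, hz.2.trans hy.2⟩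
    · exact mul_nonneg (by positivity)
        (intervalIntegral.integral_nonneg hy.1 fun z hz => hU0 z ⟨hz.1, hz.2.trans hy.2⟩)
    · rw [sub_self, Set.uIcc_of_le hy.1, Set.uIcc_of_le zero_le_one]
      exact Set.Icc_subset_Icc_right hy.2
  · rw [Set.indicator_of_notMem hw, Set.indicator_of_notMem hw]

lemma expect_waitSet_zero (τ : Strategy) :
    expect 0 ((τ.waitSet 0).indicator fun h => ENNReal.ofReal (U 0 (1 - lastTime h.1))) =
      ENNReal.ofReal (U 0 1) := by
  rw [expect, Set.indicator_of_mem]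
  · simp
  · exact fun k => k.elim0

/-- Upper bound for the payoff by a solution of the optimality equation. -/
theorem payoff_le (hS : ∀ k, Continuous (S k)) (hU : ∀ k, Continuous (U k))
    (hV : ∀ k < n, IntervalIntegrable (V k) volume 0 1)
    (hU0 : ∀ k, ∀ y ∈ Set.Icc (0 : ℝ) 1, 0 ≤ U k y)
    (hSV : ∀ k < n, ∀ y ∈ Set.Icc (0 : ℝ) 1, S k y ≤ V k y)
    (hUV : ∀ k < n, ∀ y ∈ Set.Icc (0 : ℝ) 1, U (k + 1) y ≤ V k y)
    (hrec : ∀ k < n, ∀ y ∈ Set.Icc (0 : ℝ) 1, (k = 0 → y = 1) →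
      (∫ z in (0 : ℝ)..y, V k z) + k * ∫ z in (0 : ℝ)..y, U (k + 1) z = U k y)
    (τ : Strategy) : payoff τ S n ≤ ENNReal.ofReal (U 0 1) := by
  -- Supermartingale argument: the payoff collected so far plus the value of waiting does not
  -- increase with `m`.
  suffices H : ∀ m ≤ n, payoff τ S m + expect m ((τ.waitSet m).indicator fun h =>
      ENNReal.ofReal (U m (1 - lastTime h.1))) ≤ ENNReal.ofReal (U 0 1) from
    le_self_add.trans (H n le_rfl)
  intro m hm
  induction m with
  | zero =>
    rw [expect_waitSet_zero]
    simp [payoff]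
  | succ m ih =>
    refine le_trans ?_ (ih (by omega))
    rw [payoff, Finset.sum_range_succ, ← payoff, add_assoc]
    refine add_le_add_right ?_ _
    rw [← expect_waitSet_eq τ m (hU _) (hV m hm) (hU0 _)
      (fun y hy => (hU0 _ y hy).trans (hUV m hm y hy)) (hrec m hm), ← expect_add
      ((measurable_ofReal_timeLeft (hS m)).indicator (τ.measurableSet_stopSet m))]
    rw [← expect_succ_of_push (F := fun h => (τ.waitSet m).indicator (fun _ =>
      if h.2 (Fin.last m) = 1 then ENNReal.ofReal (V m (1 - lastTime h.1)) else
        ENNReal.ofReal (U (m + 1) (1 - lastTime h.1))) (Fin.init h.1, Fin.init h.2))]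
    · refine expect_mono fun h hh => ?_
      obtain ⟨h', x, i, rfl⟩ : ∃ (h' : History m) (x : ℝ) (i : ℕ), h = h'.push x i :=
        ⟨(Fin.init h.1, Fin.init h.2), h.1 (Fin.last _), h.2 (Fin.last _), by simp [History.push]⟩
      have hx : lastTime (h'.push x i).1 = x := by simp [History.push]
      rw [hx] at hh
      have hy : 1 - x ∈ Set.Icc (0 : ℝ) 1 := ⟨sub_nonneg.2 hh.2, by linarith [hh.1]⟩
      rw [τ.indicator_stopSet_add_waitSet_push]
      by_cases hw : h' ∈ τ.waitSet m
      · rw [Set.indicator_of_mem hw, hx]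
        have hpush : (Fin.init (h'.push x i).1, Fin.init (h'.push x i).2) = h' := by
          simp [History.push]
        have hi' : (h'.push x i).2 (Fin.last m) = i := by simp [History.push]
        rw [hpush, Set.indicator_of_mem hw, hi']
        split_ifs with ha hi hi
        · exact ENNReal.ofReal_le_ofReal (hSV m hm _ hy)
        -- A non-record is never accepted.
        · exact absurd (hi' ▸ τ.record_of_mem m _ ha) hi
        · exact ENNReal.ofReal_le_ofReal (hUV m hm _ hy)
        · exact le_rfl
      · rw [Set.indicator_of_notMem hw]
        exact zero_le
    · intro h x _ i
      simp [History.push]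

/-- The payoff of a strategy given by cutoffs. -/
theorem payoff_cutoffStrategy (a : ℕ → ℝ) (hS : ∀ k, Continuous (S k)) (hU : ∀ k, Continuous (U k))
    (hV : ∀ k < n, IntervalIntegrable (V k) volume 0 1)
    (hU0 : ∀ k, ∀ y ∈ Set.Icc (0 : ℝ) 1, 0 ≤ U k y)
    (hV0 : ∀ k < n, ∀ y ∈ Set.Icc (0 : ℝ) 1, 0 ≤ V k y)
    (hVa : ∀ k < n, ∀ y ∈ Set.Icc (0 : ℝ) 1,
      V k y = if y ≤ 1 - a (k + 1) then S k y else U (k + 1) y)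
    (hrec : ∀ k < n, ∀ y ∈ Set.Icc (0 : ℝ) 1, (k = 0 → y = 1) →
      (∫ z in (0 : ℝ)..y, V k z) + k * ∫ z in (0 : ℝ)..y, U (k + 1) z = U k y)
    (hUn : ∀ y, U n y = 0) :
    payoff (cutoffStrategy a) S n = ENNReal.ofReal (U 0 1) := by
  set τ := cutoffStrategy a with hτ
  -- Here the potential is constant, because `V` is what the strategy itself collects at a record;
  -- it ends with `U n = 0`.
  have H : ∀ m ≤ n, payoff τ S m + expect m ((τ.waitSet m).indicator fun h =>
      ENNReal.ofReal (U m (1 - lastTime h.1))) = ENNReal.ofReal (U 0 1) := by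
    intro m hm
    induction m with
    | zero =>
      rw [expect_waitSet_zero]
      simp [payoff]
    | succ m ih =>
      refine Eq.trans ?_ (ih (by omega))
      rw [payoff, Finset.sum_range_succ, ← payoff, add_assoc]
      congr 1
      rw [← expect_waitSet_eq τ m (hU _) (hV m hm) (hU0 _) (hV0 m hm) (hrec m hm), ← expect_add
        ((measurable_ofReal_timeLeft (hS m)).indicator (τ.measurableSet_stopSet m))]
      refine expect_succ_of_push fun h x hx i => ?_
      have hx1 : lastTime (h.push x i).1 = x := by simp [History.push]
      have hy : 1 - x ∈ Set.Icc (0 : ℝ) 1 := ⟨sub_nonneg.2 hx.2, by linarith [hx.1]⟩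
      have hacc : h.push x i ∈ τ.accept m ↔ a (m + 1) ≤ x ∧ i = 1 := by
        simp [hτ, cutoffStrategy, History.push]
      rw [τ.indicator_stopSet_add_waitSet_push, hx1, hVa m hm _ hy]
      simp only [hacc, sub_le_sub_iff_left]
      congr 1
      funext _
      by_cases ha : a (m + 1) ≤ x <;> by_cases hi : i = 1 <;> simp [ha, hi]
  rw [← H n le_rfl]
  simp [hUn, expect_zero]

end Recursion

/-! ### Two-point laws and cutoff values -/

lemma twoPoint_apply (m n : ℕ+) (p : Set.Icc (0 : ℝ) 1) (k : ℕ+) :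
    twoPoint m n p k = (if k = m then ENNReal.ofReal (1 - p) else 0) +
      (if k = n then ENNReal.ofReal p else 0) := rfl

lemma W_twoPoint {m n : ℕ+} (hmn : m ≠ n) (p : Set.Icc (0 : ℝ) 1) (τ : Strategy) :
    W τ (twoPoint m n p) = (1 - p) * winProb τ m + p * winProb τ n := by
  have h0 : (0 : ℝ) ≤ 1 - p := sub_nonneg.2 p.2.2
  rw [W, tsum_eq_sum (s := {m, n}), Finset.sum_pair hmn]
  · simp [twoPoint_apply, hmn, hmn.symm, h0, p.2.1]
  · intro k hk
    simp only [Finset.mem_insert, Finset.mem_singleton, not_or] at hk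
    simp [twoPoint_apply, hk.1, hk.2]

lemma ofReal_W_twoPoint {m n : ℕ+} (hmn : m < n) (p : Set.Icc (0 : ℝ) 1) (τ : Strategy) :
    ENNReal.ofReal (W τ (twoPoint m n p)) = payoff τ (mixWeight m n p) n := by
  have hle : (m : ℕ) ≤ n := by exact_mod_cast hmn.le
  rw [W_twoPoint hmn.ne, payoff_mixWeight τ m.pos hle p.2]

lemma W_nonneg (τ : Strategy) (ν : PMF ℕ+) : 0 ≤ W τ ν :=
  tsum_nonneg fun _ => mul_nonneg ENNReal.toReal_nonneg (winProb_nonneg _ _)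

lemma intervalIntegrable_ite {f g : ℝ → ℝ} (hf : Continuous f) (hg : Continuous g) (b u v : ℝ) :
    IntervalIntegrable (fun z => if z ≤ b then f z else g z) volume u v := by
  rw [intervalIntegrable_iff]
  have h1 := intervalIntegrable_iff.1 (hf.intervalIntegrable (μ := volume) u v)
  have h2 := intervalIntegrable_iff.1 (hg.intervalIntegrable (μ := volume) u v)
  exact Integrable.piecewise (s := Set.Iic b) measurableSet_Iic h1.integrableOn h2.integrableOn

lemma integral_ite {f g : ℝ → ℝ} (hf : Continuous f) (hg : Continuous g) {b y : ℝ}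
    (hb : 0 ≤ b) (hy : 0 ≤ y) :
    ∫ z in (0 : ℝ)..y, (if z ≤ b then f z else g z) =
      (∫ z in (0 : ℝ)..min y b, f z) + ∫ z in (min y b)..y, g z := by
  rw [← intervalIntegral.integral_add_adjacent_intervals
    (intervalIntegrable_ite hf hg b 0 (min y b)) (intervalIntegrable_ite hf hg b (min y b) y)]
  congr 1
  · refine intervalIntegral.integral_congr fun z hz => ?_
    rw [Set.uIcc_of_le (le_min hy hb)] at hz
    exact if_pos (hz.2.trans (min_le_right _ _))
  · refine intervalIntegral.integral_congr_ae (.of_forall fun z hz => ?_)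
    rw [Set.uIoc_of_le (min_le_left _ _)] at hz
    exact if_neg fun hzb => absurd hz.1 (not_lt.2 (le_min hz.2 hzb))

section Cutoff

variable {n : ℕ} {S U : ℕ → ℝ → ℝ} {a : ℕ → ℝ}

/-- `U` solves the recursion for the value of continuing under the cutoffs `a`. -/
structure IsCutoffValue (n : ℕ) (S U : ℕ → ℝ → ℝ) (a : ℕ → ℝ) : Prop where
  cutoff_le : ∀ k < n, a (k + 1) ≤ 1
  continuous_weight : ∀ k, Continuous (S k)
  continuous_value : ∀ k, Continuous (U k)
  weight_nonneg : ∀ k, ∀ y ∈ Set.Icc (0 : ℝ) 1, 0 ≤ S k y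
  value_nonneg : ∀ k, ∀ y ∈ Set.Icc (0 : ℝ) 1, 0 ≤ U k y
  value_last : ∀ y, U n y = 0
  value_eq : ∀ k < n, ∀ y ∈ Set.Icc (0 : ℝ) 1, (k = 0 → y = 1) →
    (∫ z in (0 : ℝ)..min y (1 - a (k + 1)), S k z) + (∫ z in (min y (1 - a (k + 1)))..y, U (k + 1) z) +
      k * ∫ z in (0 : ℝ)..y, U (k + 1) z = U k y

theorem IsCutoffValue.payoff_eq (h : IsCutoffValue n S U a) :
    payoff (cutoffStrategy a) S n = ENNReal.ofReal (U 0 1) := by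
  refine payoff_cutoffStrategy
    (V := fun k y => if y ≤ 1 - a (k + 1) then S k y else U (k + 1) y) a h.continuous_weight
    h.continuous_value (fun k _ => intervalIntegrable_ite (h.continuous_weight _)
    (h.continuous_value _) _ _ _) h.value_nonneg (fun k hk y hy => ?_) (fun _ _ _ _ => rfl)
    (fun k hk y hy h0 => ?_) h.value_last
  · split_ifs
    exacts [h.weight_nonneg _ _ hy, h.value_nonneg _ _ hy]
  · rw [integral_ite (h.continuous_weight _) (h.continuous_value _)
      (sub_nonneg.2 (h.cutoff_le k hk)) hy.1]
    exact h.value_eq k hk y hy h0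

/-- If stopping is at least as good as waiting wherever the cutoffs accept a record, and no better
elsewhere, then the value at a record dominates both options, and the general upper bound equals the
payoff of the cutoffs. -/
theorem IsCutoffValue.payoff_le (h : IsCutoffValue n S U a)
    (hacc : ∀ k < n, ∀ y ∈ Set.Icc (0 : ℝ) 1, y ≤ 1 - a (k + 1) → U (k + 1) y ≤ S k y)
    (hgo : ∀ k < n, ∀ y ∈ Set.Icc (0 : ℝ) 1, 1 - a (k + 1) < y → S k y ≤ U (k + 1) y)
    (τ : Strategy) : payoff τ S n ≤ payoff (cutoffStrategy a) S n := by
  rw [h.payoff_eq]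
  refine BestChoice.payoff_le
    (V := fun k y => if y ≤ 1 - a (k + 1) then S k y else U (k + 1) y) h.continuous_weight
    h.continuous_value (fun k _ => intervalIntegrable_ite (h.continuous_weight _)
    (h.continuous_value _) _ _ _) h.value_nonneg (fun k hk y hy => ?_) (fun k hk y hy => ?_)
    (fun k hk y hy h0 => ?_) τ
  · split_ifs with hc
    exacts [le_rfl, hgo k hk y hy (not_le.1 hc)]
  · split_ifs with hc
    exacts [hacc k hk y hy hc, le_rfl]
  · rw [integral_ite (h.continuous_weight _) (h.continuous_value _)
      (sub_nonneg.2 (h.cutoff_le k hk)) hy.1]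
    exact h.value_eq k hk y hy h0

end Cutoff

lemma mixWeight_nonneg (m n : ℕ) {p : ℝ} (hp : p ∈ Set.Icc (0 : ℝ) 1) (k : ℕ) {y : ℝ}
    (hy : 0 ≤ y) : 0 ≤ mixWeight m n p k y :=
  add_nonneg (mul_nonneg (sub_nonneg.2 hp.2) (stopWeight_nonneg _ _ hy))
    (mul_nonneg hp.1 (stopWeight_nonneg _ _ hy))

/-- `∫` of a combination of two monomials. -/
lemma integral_monomials (c d u v : ℝ) (i j : ℕ) :
    ∫ z in u..v, (c * z ^ i + d * z ^ j) =
      c * ((v ^ (i + 1) - u ^ (i + 1)) / (i + 1)) + d * ((v ^ (j + 1) - u ^ (j + 1)) / (j + 1)) := by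
  have h1 : Continuous fun z : ℝ => c * z ^ i := by fun_prop
  have h2 : Continuous fun z : ℝ => d * z ^ j := by fun_prop
  rw [intervalIntegral.integral_add (h1.intervalIntegrable _ _) (h2.intervalIntegrable _ _)]
  simp only [intervalIntegral.integral_const_mul, integral_pow]

lemma integral_mixWeight (m n : ℕ) (p : ℝ) (k : ℕ) (u v : ℝ) :
    ∫ z in u..v, mixWeight m n p k z =
      (1 - p) * ((m - 1).choose k) * ((v ^ (m - 1 - k + 1) - u ^ (m - 1 - k + 1)) / ((m - 1 - k : ℕ) + 1)) +
      p * ((n - 1).choose k) * ((v ^ (n - 1 - k + 1) - u ^ (n - 1 - k + 1)) / ((n - 1 - k : ℕ) + 1)) := by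
  rw [← integral_monomials]
  refine intervalIntegral.integral_congr fun z _ => ?_
  simp only [mixWeight, stopWeight]
  ring

lemma isOptimal_twoPoint {m n : ℕ+} (hmn : m < n) {p : Set.Icc (0 : ℝ) 1} {τ : Strategy}
    (h : ∀ σ, payoff σ (mixWeight m n p) n ≤ payoff τ (mixWeight m n p) n) :
    IsOptimal W τ (twoPoint m n p) := by
  intro σ
  have := h σ
  rw [← ofReal_W_twoPoint hmn, ← ofReal_W_twoPoint hmn] at this
  exact (ENNReal.ofReal_le_ofReal_iff (W_nonneg _ _)).1 this

/-! ### The dynamic program on {1, 4} -/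

/-- The value of continuing after `k` arrivals under `strategyA b`. -/
noncomputable def valueA (b p : ℝ) : ℕ → ℝ → ℝ
  | 0, _ => (1 - p) * b + p / 24 * (11 - 5 * b ^ 4)
  | 1, y => 11 / 6 * p * y ^ 3
  | 2, y => 5 / 2 * p * y ^ 2
  | 3, y => p * y
  | _, _ => 0

/-- The stopping weights are `1 - p + p y³`, `3 p y²`, `3 p y`, `p`; integrating backwards gives the
coefficients `1`, `3/2 + 1 = 5/2` and `1 + 5/6 = 11/6`. -/
lemma isCutoffValue_valueA {b p : ℝ} (hb : b ∈ Set.Icc (0 : ℝ) 1) (hp : p ∈ Set.Icc (0 : ℝ) 1) :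
    IsCutoffValue 4 (mixWeight 1 4 p) (valueA b p) (fun k => if k = 1 then 1 - b else 0) where
  cutoff_le k _ := by
    split_ifs <;> linarith [hb.1]
  continuous_weight := continuous_mixWeight _ _ _
  continuous_value k := by
    rcases k with _ | _ | _ | _ | k <;> unfold valueA <;> fun_prop
  weight_nonneg k y hy := mixWeight_nonneg _ _ hp _ hy.1
  value_nonneg k y hy := by
    have h0 := hp.1
    have h1 := hy.1
    rcases k with _ | _ | _ | _ | k <;> simp only [valueA]
    · have : b ^ 4 ≤ 1 := pow_le_one₀ hb.1 hb.2
      have h2 : 0 ≤ (1 - p) * b := mul_nonneg (sub_nonneg.2 hp.2) hb.1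
      have h3 : 0 ≤ p / 24 * (11 - 5 * b ^ 4) := mul_nonneg (by positivity) (by linarith)
      linarith
    all_goals positivity
  value_last y := rfl
  value_eq k hk y hy h0 := by
    have e1 : min y 1 = y := min_eq_left hy.2
    have e2 : ∫ z in (0 : ℝ)..y, p * z = p * y ^ 2 / 2 := by
      rw [intervalIntegral.integral_const_mul, integral_id]
      ring
    interval_cases k
    · obtain rfl := h0 rfl
      have e : min (1 : ℝ) (1 - (1 - b)) = b := by simpa using hb.2
      simp only [zero_add, if_true, e]
      simp [integral_mixWeight, valueA]
      ring
    all_goals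
      simp [e1, e2, integral_mixWeight, valueA]
      try ring

lemma W_strategyA (b p : Set.Icc (0 : ℝ) 1) : W (strategyA b) (twoPoint 1 4 p) =
    (1 - p) * b + p / 24 * (11 - 5 * (b : ℝ) ^ 4) := by
  have h := isCutoffValue_valueA b.2 p.2
  have h1 := ofReal_W_twoPoint (m := 1) (n := 4) (by decide) p (strategyA b)
  have h2 := h1.trans h.payoff_eq
  rw [ENNReal.ofReal_eq_ofReal_iff (W_nonneg _ _) (h.value_nonneg 0 1 (by simp))] at h2
  exact h2

/-- At index `1`, stopping beats waiting iff `5/6 * p * y ^ 3 ≤ 1 - p`, where `5/6 = 11/6 - 1`; at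
later indices stopping is always at least as good. For `b = 1` no time is rejected, so the
inequality suffices. -/
lemma isOptimal_strategyA {b : ℝ} {p : Set.Icc (0 : ℝ) 1} (hb : b ∈ Set.Icc (0 : ℝ) 1)
    (h1 : 5 / 6 * p * b ^ 3 ≤ 1 - p) (h2 : b < 1 → 5 / 6 * p * b ^ 3 = 1 - p) :
    IsOptimal W (strategyA b) (twoPoint 1 4 p) := by
  have hp0 : (0 : ℝ) ≤ p := p.2.1
  refine isOptimal_twoPoint (by decide) ((isCutoffValue_valueA hb p.2).payoff_le ?_ ?_)
  · intro k hk y hy hyc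
    have hy0 := hy.1
    change k < 4 at hk
    interval_cases k
    · simp [valueA, mixWeight, stopWeight] at hyc ⊢
      have : 5 / 6 * (p : ℝ) * y ^ 3 ≤ 5 / 6 * p * b ^ 3 := by gcongr
      linarith
    all_goals simp [valueA, mixWeight, stopWeight]
    · nlinarith [mul_nonneg hp0 (sq_nonneg y), mul_le_mul_of_nonneg_left hy.2 (mul_nonneg hp0 (sq_nonneg y))]
    · nlinarith [mul_nonneg hp0 hy0]
    · exact hp0
  · intro k hk y hy hyc
    change k < 4 at hk
    interval_cases k
    · simp [valueA, mixWeight, stopWeight] at hyc ⊢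
      have : 5 / 6 * (p : ℝ) * b ^ 3 ≤ 5 / 6 * p * y ^ 3 := by
        have := hb.1
        gcongr
      linarith [h2 (hyc.trans_le hy.2)]
    all_goals
      simp at hyc
      exact absurd hy.2 (not_le.2 hyc)

/-! ### The dynamic program on {3, 6} -/

/-- The value of continuing after `k` arrivals under `strategyB b`. -/
noncomputable def valueB (b p : ℝ) : ℕ → ℝ → ℝ
  | 0, _ => (1 - p) * (1 / 3 + b ^ 2 / 2 - b ^ 3 / 3) +
      p * (77 / 180 - 17 / 60 * b ^ 5 + 17 / 72 * b ^ 6)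
  | 1, y => (1 - p) * (y ^ 2 + (min y b) ^ 2 / 2) +
      p * (77 / 30 * y ^ 5 - 17 / 60 * (min y b) ^ 5)
  | 2, y => (1 - p) * y ^ 1 + 77 / 12 * p * y ^ 4
  | 3, y => 47 / 6 * p * y ^ 3
  | 4, y => 9 / 2 * p * y ^ 2
  | 5, y => p * y
  | _, _ => 0

/-- The value after one arrival changes its formula where the time left is `b`, so the integral is
split there. -/
lemma integral_valueB_one {b p : ℝ} (hb : b ∈ Set.Icc (0 : ℝ) 1) :
    ∫ y in (0 : ℝ)..1, valueB b p 1 y = valueB b p 0 1 := by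
  have hc : Continuous (valueB b p 1) := by unfold valueB; fun_prop
  rw [← intervalIntegral.integral_add_adjacent_intervals (hc.intervalIntegrable 0 b)
    (hc.intervalIntegrable b 1)]
  have h1 : ∫ y in (0 : ℝ)..b, valueB b p 1 y =
      ∫ y in (0 : ℝ)..b, ((1 - p) * (3 / 2) * y ^ 2 + p * (137 / 60) * y ^ 5) := by
    refine intervalIntegral.integral_congr fun y hy => ?_
    rw [Set.uIcc_of_le hb.1] at hy
    simp only [valueB, min_eq_left hy.2]
    ring
  have h2 : ∫ y in b..1, valueB b p 1 y =
      ∫ y in b..1, ((1 - p) * y ^ 2 + p * (77 / 30) * y ^ 5 +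
        ((1 - p) * (b ^ 2 / 2) - p * (17 / 60 * b ^ 5))) := by
    refine intervalIntegral.integral_congr fun y hy => ?_
    rw [Set.uIcc_of_le hb.2] at hy
    simp only [valueB, min_eq_right hy.1]
    ring
  have hc2 : Continuous fun y : ℝ => (1 - p) * y ^ 2 + p * (77 / 30) * y ^ 5 := by fun_prop
  rw [h1, h2, intervalIntegral.integral_add (hc2.intervalIntegrable _ _)
    (continuous_const.intervalIntegrable _ _), integral_monomials, integral_monomials,
    intervalIntegral.integral_const]
  simp only [valueB, smul_eq_mul]
  push_cast
  ring

lemma isCutoffValue_valueB {b p : ℝ} (hb : b ∈ Set.Icc (0 : ℝ) 1) (hp : p ∈ Set.Icc (0 : ℝ) 1) :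
    IsCutoffValue 6 (mixWeight 3 6 p) (valueB b p)
      (fun k => if k = 1 then 1 else if k = 2 then 1 - b else 0) where
  cutoff_le k _ := by
    split_ifs <;> linarith [hb.1]
  continuous_weight := continuous_mixWeight _ _ _
  continuous_value k := by
    rcases k with _ | _ | _ | _ | _ | _ | k <;> unfold valueB <;> fun_prop
  weight_nonneg k y hy := mixWeight_nonneg _ _ hp _ hy.1
  value_nonneg k y hy := by
    have h0 := hp.1
    have h1 := hy.1
    have hp1 : 0 ≤ 1 - p := sub_nonneg.2 hp.2
    rcases k with _ | _ | _ | _ | _ | _ | k <;> simp only [valueB]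
    · have h5 : b ^ 5 ≤ 1 := pow_le_one₀ hb.1 hb.2
      have h6 : 0 ≤ b ^ 6 := by positivity
      have h3 : b ^ 3 ≤ 1 := pow_le_one₀ hb.1 hb.2
      refine add_nonneg (mul_nonneg hp1 ?_) (mul_nonneg h0 ?_)
      · linarith [sq_nonneg b]
      · linarith
    · have hm : 0 ≤ min y b := le_min hy.1 hb.1
      have h5 : min y b ^ 5 ≤ y ^ 5 := by gcongr; exact min_le_left _ _
      have hy5 : 0 ≤ y ^ 5 := by positivity
      refine add_nonneg (mul_nonneg hp1 (by positivity)) (mul_nonneg h0 ?_)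
      linarith
    all_goals positivity
  value_last y := rfl
  value_eq k hk y hy h0 := by
    have e1 : min y 1 = y := min_eq_left hy.2
    have e2 : ∫ z in (0 : ℝ)..y, p * z = p * y ^ 2 / 2 := by
      rw [intervalIntegral.integral_const_mul, integral_id]
      ring
    interval_cases k
    · obtain rfl := h0 rfl
      -- The cutoff `1` leaves no interval of acceptance at index `1`.
      simp [integral_valueB_one hb]
    · have e3 : ∀ u v : ℝ, ∫ z in u..v, valueB b p (1 + 1) z =
          (1 - p) * ((v ^ 2 - u ^ 2) / 2) + 77 / 12 * p * ((v ^ 5 - u ^ 5) / 5) := by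
        intro u v
        have := integral_monomials (1 - p) (77 / 12 * p) u v 1 4
        norm_num at this
        simpa [valueB] using this
      simp [integral_mixWeight, e3]
      simp [valueB]
      ring
    all_goals
      simp [e1, e2, integral_mixWeight, valueB, Nat.choose]
      try ring

lemma W_strategyB (b p : Set.Icc (0 : ℝ) 1) : W (strategyB b) (twoPoint 3 6 p) =
    (1 - p) * (1 / 3 + (b : ℝ) ^ 2 / 2 - (b : ℝ) ^ 3 / 3) +
      p * (77 / 180 - 17 / 60 * (b : ℝ) ^ 5 + 17 / 72 * (b : ℝ) ^ 6) := by
  have h := isCutoffValue_valueB b.2 p.2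
  have h1 := ofReal_W_twoPoint (m := 3) (n := 6) (by decide) p (strategyB b)
  have h2 := h1.trans h.payoff_eq
  rw [ENNReal.ofReal_eq_ofReal_iff (W_nonneg _ _) (h.value_nonneg 0 1 (by simp))] at h2
  exact h2

/-- At index `2` the weight `2 (1 - p) y + 5 p y⁴` competes with `(1 - p) y + 77/12 p y⁴`, and
`77/12 - 5 = 17/12`. At index `1` waiting is always at least as good, later stopping is. -/
lemma isOptimal_strategyB {b : ℝ} {p : Set.Icc (0 : ℝ) 1} (hb : b ∈ Set.Icc (0 : ℝ) 1)
    (h1 : 17 / 12 * p * b ^ 3 ≤ 1 - p) (h2 : b < 1 → 17 / 12 * p * b ^ 3 = 1 - p) :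
    IsOptimal W (strategyB b) (twoPoint 3 6 p) := by
  have hp0 : (0 : ℝ) ≤ p := p.2.1
  have hp1 : (0 : ℝ) ≤ 1 - p := sub_nonneg.2 p.2.2
  refine isOptimal_twoPoint (by decide) ((isCutoffValue_valueB hb p.2).payoff_le ?_ ?_)
  · intro k hk y hy hyc
    have hy0 := hy.1
    change k < 6 at hk
    interval_cases k
    · simp at hyc
      -- The cutoff `1` accepts only when no time is left, where both values vanish.
      obtain rfl : y = 0 := le_antisymm hyc hy0
      simp [valueB, mixWeight, stopWeight, hb.1]
    · simp at hyc
      have : 17 / 12 * (p : ℝ) * y ^ 3 ≤ 17 / 12 * p * b ^ 3 := by gcongr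
      have := mul_le_mul_of_nonneg_left (this.trans h1) hy0
      simp [valueB, mixWeight, stopWeight]
      linarith
    · have h3 := mul_le_mul_of_nonneg_left hy.2 hp1
      have h4 : (p : ℝ) * y ^ 3 ≥ 0 := by positivity
      simp [valueB, mixWeight, stopWeight, Nat.choose]
      linarith
    · have h4 : (p : ℝ) * y ^ 2 ≥ 0 := by positivity
      simp [valueB, mixWeight, stopWeight, Nat.choose]
      linarith
    all_goals
      simp [valueB, mixWeight, stopWeight, Nat.choose]
      nlinarith [mul_nonneg hp0 hy0]
  · intro k hk y hy hyc
    have hy0 := hy.1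
    change k < 6 at hk
    interval_cases k
    · have hm : 0 ≤ min y b := le_min hy.1 hb.1
      have h5 : min y b ^ 5 ≤ y ^ 5 := by gcongr; exact min_le_left _ _
      have hy5 : 0 ≤ y ^ 5 := by positivity
      simp [valueB, mixWeight, stopWeight]
      gcongr
      · linarith [sq_nonneg (min y b)]
      · linarith
    · simp at hyc
      have : 17 / 12 * (p : ℝ) * b ^ 3 ≤ 17 / 12 * p * y ^ 3 := by
        have := hb.1
        gcongr
      have := mul_le_mul_of_nonneg_left ((h2 (hyc.trans_le hy.2)).ge.trans this) hy0
      simp [valueB, mixWeight, stopWeight]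
      linarith
    all_goals
      simp at hyc
      exact absurd hy.2 (not_le.2 hyc)

/-! ### Optimal values, stochastic order and conventions -/

lemma optValue_eq_of_isOptimal {F : Strategy → PMF ℕ+ → ℝ} {τ : Strategy} {ν : PMF ℕ+}
    (h : IsOptimal F τ ν) : optValue F ν = F τ ν := by
  have : Nonempty Strategy := ⟨τ⟩
  exact le_antisymm (ciSup_le h) (le_ciSup (f := fun σ => F σ ν)
    ⟨F τ ν, by rintro _ ⟨σ, rfl⟩; exact h σ⟩ τ)

lemma winProb_le_one (τ : Strategy) (n : ℕ) : winProb τ n ≤ 1 := measureReal_le_one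

lemma W_twoPoint_le_optValue {m n : ℕ+} (hmn : m ≠ n) (p : Set.Icc (0 : ℝ) 1) (τ : Strategy) :
    W τ (twoPoint m n p) ≤ optValue W (twoPoint m n p) := by
  refine le_ciSup (f := fun σ => W σ (twoPoint m n p)) ⟨1, ?_⟩ τ
  rintro _ ⟨σ, rfl⟩
  dsimp only
  rw [W_twoPoint hmn]
  have h1 := mul_le_mul_of_nonneg_left (winProb_le_one σ m) (sub_nonneg.2 p.2.2)
  have h2 := mul_le_mul_of_nonneg_left (winProb_le_one σ n) p.2.1
  linarith

lemma toOuterMeasure_twoPoint {m n : ℕ+} (hmn : m ≠ n) (p : Set.Icc (0 : ℝ) 1) (k : ℕ+) :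
    (twoPoint m n p).toOuterMeasure (Set.Ici k) =
      (if k ≤ m then ENNReal.ofReal (1 - p) else 0) + (if k ≤ n then ENNReal.ofReal p else 0) := by
  rw [PMF.toOuterMeasure_apply, tsum_eq_sum (s := {m, n}), Finset.sum_pair hmn]
  · simp [Set.indicator, twoPoint_apply, hmn, hmn.symm]
  · intro l hl
    simp only [Finset.mem_insert, Finset.mem_singleton, not_or] at hl
    simp [Set.indicator, twoPoint_apply, hl.1, hl.2]

lemma stochLT_twoPoint {m n : ℕ+} (hmn : m < n) {p q : Set.Icc (0 : ℝ) 1} (hpq : p < q) :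
    StochLT (twoPoint m n p) (twoPoint m n q) := by
  have hlt : (p : ℝ) < q := hpq
  constructor
  · intro h
    have := DFunLike.congr_fun h n
    simp only [twoPoint_apply, hmn.ne', if_false, if_true, zero_add] at this
    rw [ENNReal.ofReal_eq_ofReal_iff p.2.1 q.2.1] at this
    exact hlt.ne this
  · intro k
    rw [toOuterMeasure_twoPoint hmn.ne, toOuterMeasure_twoPoint hmn.ne]
    by_cases hk : k ≤ m
    · rw [if_pos hk, if_pos hk, if_pos (hk.trans hmn.le), if_pos (hk.trans hmn.le),
        ← ENNReal.ofReal_add (sub_nonneg.2 p.2.2) p.2.1,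
        ← ENNReal.ofReal_add (sub_nonneg.2 q.2.2) q.2.1, sub_add_cancel, sub_add_cancel]
    · rw [if_neg hk, if_neg hk, zero_add, zero_add]
      split_ifs
      · exact ENNReal.ofReal_le_ofReal hlt.le
      · exact le_rfl

lemma twoPoint_one (m n : ℕ+) (h : (1 : ℝ) ∈ Set.Icc (0 : ℝ) 1) :
    twoPoint m n ⟨1, h⟩ = PMF.pure n := by
  ext k
  simp [twoPoint_apply, PMF.pure_apply]

lemma altW_twoPoint {m n : ℕ+} (hm : 1 < m) (hn : 1 < n) (p : Set.Icc (0 : ℝ) 1) (τ : Strategy) :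
    altW τ (twoPoint m n p) = W τ (twoPoint m n p) := by
  simp [altW, twoPoint_apply, hm.ne, hn.ne]

lemma cutoffStrategy_congr {a b : ℕ → ℝ} (h : ∀ k, a (k + 1) = b (k + 1)) :
    cutoffStrategy a = cutoffStrategy b := by
  simp only [cutoffStrategy, h]

lemma dStrategy_two : dStrategy 2 = strategyA 0 := by
  -- The two cutoff sequences differ at index `0`, which is never used.
  refine cutoffStrategy_congr fun k => ?_
  rcases k with _ | k <;> simp

lemma cubeRoot_spec {x : ℝ} (hx : 0 ≤ x) :
    0 ≤ x ^ (1 / 3 : ℝ) ∧ (x ^ (1 / 3 : ℝ)) ^ 3 = x := by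
  refine ⟨Real.rpow_nonneg hx _, ?_⟩
  rw [← Real.rpow_natCast, ← Real.rpow_mul hx]
  norm_num

/-- If the optimal value is attained at a cutoff `b` with `c * q * b ^ 3 = 1 - q`, then it increases
strictly in `q` as soon as the payoff is in favour of the larger number of items. -/
lemma strictMonoOn_optValue {m n : ℕ+} {f g : ℝ → ℝ} {c : ℝ} (hc : 0 < c)
    (hopt : ∀ q : Set.Icc (0 : ℝ) 1, ∀ b ∈ Set.Icc (0 : ℝ) 1, c * q * b ^ 3 = 1 - q →
      optValue W (twoPoint m n q) = (1 - q) * f b + q * g b)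
    (hanti : ∀ q : Set.Icc (0 : ℝ) 1, ∀ b ∈ Set.Icc (0 : ℝ) 1, c * q * b ^ 3 = 1 - q →
      StrictAntiOn (fun x => (1 - (q : ℝ)) * f x + q * g x) (Set.Icc b 1))
    {b p : Set.Icc (0 : ℝ) 1} (hbp : c * p * (b : ℝ) ^ 3 = 1 - p)
    (hfg : ∀ x ∈ Set.Icc (0 : ℝ) b, f x ≤ g x) :
    StrictMonoOn (fun q => optValue W (twoPoint m n q)) (Set.Ici p) := by
  have hp : 0 < (p : ℝ) := by
    refine lt_of_le_of_ne p.2.1 fun h => ?_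
    rw [← h] at hbp
    norm_num at hbp
  have hex : ∀ q : Set.Icc (0 : ℝ) 1, p ≤ q →
      ∃ x ∈ Set.Icc (0 : ℝ) b, c * q * x ^ 3 = 1 - q := by
    -- The optimal cutoff is the cube root of `(1 - q) / (c * q)`, which decreases in `q` and so
    -- stays below `b`.
    intro q hpq
    have hle : (p : ℝ) ≤ q := hpq
    have hq : 0 < (q : ℝ) := hp.trans_le hle
    have hx0 : 0 ≤ (1 - (q : ℝ)) / (c * q) := div_nonneg (sub_nonneg.2 q.2.2) (by positivity)
    obtain ⟨h1, h2⟩ := cubeRoot_spec hx0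
    refine ⟨_, ⟨h1, ?_⟩, ?_⟩
    · refine le_of_pow_le_pow_left₀ three_ne_zero b.2.1 ?_
      rw [h2, div_le_iff₀ (by positivity)]
      have hb3 : 0 ≤ (b : ℝ) ^ 3 := pow_nonneg b.2.1 3
      have := mul_le_mul_of_nonneg_left hle (mul_nonneg hc.le hb3)
      linarith
    · rw [h2]
      field_simp
  intro q hq q' hq' hqq'
  have hlt : (q : ℝ) < q' := hqq'
  have hq0 : 0 < (q : ℝ) := hp.trans_le (show (p : ℝ) ≤ q from hq)
  obtain ⟨x, hx, hxe⟩ := hex q hq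
  obtain ⟨x', hx', hxe'⟩ := hex q' hq'
  have hx1 : x ∈ Set.Icc (0 : ℝ) 1 := ⟨hx.1, hx.2.trans b.2.2⟩
  have hx1' : x' ∈ Set.Icc (0 : ℝ) 1 := ⟨hx'.1, hx'.2.trans b.2.2⟩
  have hxx : x' < x := by
    by_contra! hcon
    have h3 : x ^ 3 ≤ x' ^ 3 := pow_le_pow_left₀ hx.1 hcon 3
    have h4 : c * q * x ^ 3 ≤ c * q' * x' ^ 3 := by
      have := hx.1
      have := hq0.trans hlt
      gcongr
    linarith
  dsimp only
  rw [hopt q x hx1 hxe, hopt q' x' hx1' hxe']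
  -- With `w` the mixed payoff, `w(x', q') > w(x, q')` since `x'` is optimal for `q'` and `x' < x`;
  -- and `w(x, q') ≥ w(x, q)` since `f x ≤ g x`.
  have h1 := hanti q' x' hx1' hxe' ⟨le_rfl, hx1'.2⟩ ⟨hxx.le, hx1.2⟩ hxx
  dsimp only at h1
  have h2 := mul_nonneg (sub_nonneg.2 hlt.le) (sub_nonneg.2 (hfg x hx))
  linarith

/-! ### Explicit payoffs and their monotonicity -/

lemma s_two_four : s 2 4 = 11 / 24 := by
  norm_num [s, Finset.sum_Icc_succ_top]

lemma wA_eq (b p : ℝ) : wA b p = (1 - p) * b + p * ((11 - 5 * b ^ 4) / 24) := by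
  rw [wA, s_two_four]
  ring

lemma fB_three (b : ℝ) : fB 3 b = 1 / 3 + b ^ 2 / 2 - b ^ 3 / 3 := by
  simp [fB, binom, s, Finset.sum_Icc_succ_top, Nat.choose]
  ring

lemma fB_six (b : ℝ) : fB 6 b = 77 / 180 - 17 / 60 * b ^ 5 + 17 / 72 * b ^ 6 := by
  simp [fB, binom, s, Finset.sum_Icc_succ_top, Nat.choose]
  ring

lemma hasDerivAt_fB_three (x : ℝ) : HasDerivAt (fB 3) (x * (1 - x)) x := by
  rw [funext fB_three]
  refine ((((hasDerivAt_pow 2 x).div_const 2).const_add (1 / 3)).sub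
    ((hasDerivAt_pow 3 x).div_const 3)).congr_deriv ?_
  norm_num
  ring

lemma hasDerivAt_fB_six (x : ℝ) : HasDerivAt (fB 6) (-(17 / 12) * (x * (1 - x)) * x ^ 3) x := by
  rw [funext fB_six]
  refine ((((hasDerivAt_pow 5 x).const_mul (17 / 60)).const_sub (77 / 180)).add
    ((hasDerivAt_pow 6 x).const_mul (17 / 72))).congr_deriv ?_
  norm_num
  ring

/-- Strict convexity of the fourth power, by its tangents at both ends. It replaces the derivative
in the monotonicity proofs for `wA`. -/
lemma pow_four_tangent {x y : ℝ} (hx : 0 ≤ x) (hxy : x < y) :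
    x ^ 4 + 4 * x ^ 3 * (y - x) < y ^ 4 ∧ y ^ 4 < x ^ 4 + 4 * y ^ 3 * (y - x) := by
  have hd : 0 < y - x := sub_pos.2 hxy
  have hy : 0 < y := hx.trans_lt hxy
  have e1 : y ^ 4 - (x ^ 4 + 4 * x ^ 3 * (y - x)) =
      (y - x) ^ 2 * (y ^ 2 + 2 * x * y + 3 * x ^ 2) := by ring
  have e2 : x ^ 4 + 4 * y ^ 3 * (y - x) - y ^ 4 =
      (y - x) ^ 2 * (3 * y ^ 2 + 2 * x * y + x ^ 2) := by ring
  have h1 : 0 < (y - x) ^ 2 * (y ^ 2 + 2 * x * y + 3 * x ^ 2) := by positivity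
  have h2 : 0 < (y - x) ^ 2 * (3 * y ^ 2 + 2 * x * y + x ^ 2) := by positivity
  constructor <;> linarith

section

variable {b p : ℝ}

lemma pos_of_cutoff_eq {c : ℝ} (hp : 0 ≤ p) (h : c * p * b ^ 3 = 1 - p) : 0 < p := by
  refine lt_of_le_of_ne hp fun h0 => ?_
  rw [← h0] at h
  norm_num at h

lemma strictMonoOn_wA (hp : 0 ≤ p) (h : 5 / 6 * p * b ^ 3 = 1 - p) :
    StrictMonoOn (fun x => wA x p) (Set.Icc 0 b) := by
  have hp0 := pos_of_cutoff_eq hp h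
  intro x hx y hy hxy
  have h1 := mul_lt_mul_of_pos_left (pow_four_tangent hx.1 hxy).2 hp0
  have h2 : y ^ 3 ≤ b ^ 3 := pow_le_pow_left₀ hy.1 hy.2 3
  have h3 := mul_le_mul_of_nonneg_left h2 (mul_nonneg hp (sub_nonneg.2 hxy.le))
  have h4 : (1 - p) * (y - x) = 5 / 6 * p * b ^ 3 * (y - x) := by rw [h]
  simp only [wA_eq]
  linarith

lemma strictAntiOn_wA (hb : 0 ≤ b) (hp : 0 ≤ p) (h : 5 / 6 * p * b ^ 3 = 1 - p) :
    StrictAntiOn (fun x => wA x p) (Set.Icc b 1) := by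
  have hp0 := pos_of_cutoff_eq hp h
  intro x hx y hy hxy
  have h1 := mul_lt_mul_of_pos_left (pow_four_tangent (hb.trans hx.1) hxy).1 hp0
  have h2 : b ^ 3 ≤ x ^ 3 := pow_le_pow_left₀ hb hx.1 3
  have h3 := mul_le_mul_of_nonneg_left h2 (mul_nonneg hp (sub_nonneg.2 hxy.le))
  have h4 : (1 - p) * (y - x) = 5 / 6 * p * b ^ 3 * (y - x) := by rw [h]
  simp only [wA_eq]
  linarith

lemma strictAntiOn_wB (hb : 0 ≤ b) (hp : 0 ≤ p) (h : 17 / 12 * p * b ^ 3 = 1 - p) :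
    StrictAntiOn (fun x => wB x p) (Set.Icc b 1) := by
  have hp0 := pos_of_cutoff_eq hp h
  -- Replacing `1 - p` by `17/12 * p * b ^ 3` makes the sign of the derivative visible.
  have hd : ∀ x : ℝ, HasDerivAt (fun x => wB x p) (17 / 12 * p * (x * (1 - x) * (b ^ 3 - x ^ 3))) x := by
    intro x
    have := ((hasDerivAt_fB_three x).const_mul (1 - p)).add ((hasDerivAt_fB_six x).const_mul p)
    refine this.congr_deriv ?_
    rw [← h]
    ring
  refine strictAntiOn_of_deriv_neg (convex_Icc _ _)
    (fun x _ => (hd x).continuousAt.continuousWithinAt) fun x hx => ?_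
  rw [interior_Icc] at hx
  rw [(hd x).deriv]
  have hx0 : 0 < x := hb.trans_lt hx.1
  have h1 : 0 < x * (1 - x) := mul_pos hx0 (sub_pos.2 hx.2)
  have h2 : b ^ 3 - x ^ 3 < 0 := sub_neg.2 (pow_lt_pow_left₀ hx.1 hb three_ne_zero)
  exact mul_neg_of_pos_of_neg (by positivity) (mul_neg_of_pos_of_neg h1 h2)

end

lemma strictAntiOn_fB_sub : StrictAntiOn (fun x => fB 6 x - fB 3 x) (Set.Icc 0 1) := by
  have hd : ∀ x : ℝ, HasDerivAt (fun x => fB 6 x - fB 3 x)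
      (-(x * (1 - x) * (17 / 12 * x ^ 3 + 1))) x := by
    intro x
    refine ((hasDerivAt_fB_six x).sub (hasDerivAt_fB_three x)).congr_deriv ?_
    ring
  refine strictAntiOn_of_deriv_neg (convex_Icc _ _)
    (fun x _ => (hd x).continuousAt.continuousWithinAt) fun x hx => ?_
  rw [interior_Icc] at hx
  rw [(hd x).deriv]
  have hx0 := hx.1
  have h1 : 0 < x * (1 - x) := mul_pos hx.1 (sub_pos.2 hx.2)
  have : 0 < x * (1 - x) * (17 / 12 * x ^ 3 + 1) := by positivity
  linarith

lemma W_strategyA_eq_wA (b p : Set.Icc (0 : ℝ) 1) :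
    W (strategyA b) (twoPoint 1 4 p) = wA b p := by
  rw [W_strategyA, wA_eq]
  ring

lemma W_strategyB_eq_wB (b p : Set.Icc (0 : ℝ) 1) :
    W (strategyB b) (twoPoint 3 6 p) = wB b p := by
  rw [W_strategyB, wB, fB_three, fB_six]

/-- The cases `p = 0` and `p = 1` of the payoff formula. -/
lemma winProb_strategyB (b : Set.Icc (0 : ℝ) 1) :
    winProb (strategyB b) 3 = fB 3 b ∧ winProb (strategyB b) 6 = fB 6 b := by
  have h3 := W_strategyB_eq_wB b 0
  have h6 := W_strategyB_eq_wB b 1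
  rw [W_twoPoint (by decide), wB] at h3 h6
  constructor
  · simpa using h3
  · simpa using h6

lemma optValue_twoPoint_one_four {q : Set.Icc (0 : ℝ) 1} {b : ℝ} (hb : b ∈ Set.Icc (0 : ℝ) 1)
    (h : 5 / 6 * q * b ^ 3 = 1 - q) : optValue W (twoPoint 1 4 q) = wA b q := by
  rw [optValue_eq_of_isOptimal (isOptimal_strategyA hb h.le fun _ => h)]
  exact W_strategyA_eq_wA ⟨b, hb⟩ q

lemma optValue_twoPoint_three_six {q : Set.Icc (0 : ℝ) 1} {b : ℝ} (hb : b ∈ Set.Icc (0 : ℝ) 1)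
    (h : 17 / 12 * q * b ^ 3 = 1 - q) : optValue W (twoPoint 3 6 q) = wB b q := by
  rw [optValue_eq_of_isOptimal (isOptimal_strategyB hb h.le fun _ => h)]
  exact W_strategyB_eq_wB ⟨b, hb⟩ q

lemma isOptimal_dStrategy_two : IsOptimal W (dStrategy 2) (PMF.pure 4) := by
  rw [dStrategy_two, ← twoPoint_one 1 4 (by norm_num)]
  exact isOptimal_strategyA (by norm_num) (by norm_num) (by norm_num)

lemma W_pure (τ : Strategy) : W τ (PMF.pure 4) = winProb τ 4 := by
  rw [← twoPoint_one 1 4 (by norm_num), W_twoPoint (by decide)]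
  simp

lemma winProb_dStrategy_two : winProb (dStrategy 2) 4 = s 2 4 := by
  have := W_strategyA_eq_wA 0 1
  rw [← W_pure, dStrategy_two, ← twoPoint_one 1 4 (by norm_num)]
  refine this.trans ?_
  simp [wA]

lemma optValue_pure_four : optValue W (PMF.pure 4) = s 2 4 := by
  rw [optValue_eq_of_isOptimal isOptimal_dStrategy_two, W_pure, winProb_dStrategy_two]

/-! ### The saddle points -/

/-- The parameter `p` with `c * p * b ^ 3 = 1 - p`. -/
lemma exists_cutoff_eq {c b : ℝ} (hc : 0 ≤ c) (hb : 0 ≤ b) :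
    ∃ p : Set.Icc (0 : ℝ) 1, c * p * b ^ 3 = 1 - p ∧ (p : ℝ) = 1 / (1 + c * b ^ 3) := by
  have h : 0 ≤ c * b ^ 3 := by positivity
  refine ⟨⟨1 / (1 + c * b ^ 3), by positivity, ?_⟩, ?_, rfl⟩
  · rw [div_le_one (by positivity)]
    linarith
  · field_simp
    ring

theorem exists_critical_one_four : ∃ b p : Set.Icc (0 : ℝ) 1,
    0.449 < (b : ℝ) ∧ (b : ℝ) < 0.450 ∧ 0.929 < (p : ℝ) ∧ (p : ℝ) < 0.930 ∧
    (∀ x ∈ Set.Icc (0 : ℝ) 1, -x + 1 / 24 * (11 - 5 * x ^ 4) = 0 ↔ x = b) ∧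
    5 / 6 * p * (b : ℝ) ^ 3 = 1 - p := by
  have hcont : ContinuousOn (fun x : ℝ => -x + 1 / 24 * (11 - 5 * x ^ 4))
      (Set.Icc 0.449 0.450) := by fun_prop
  obtain ⟨b, hb, hb0⟩ := intermediate_value_Ioo' (by norm_num) hcont
    (show (0 : ℝ) ∈ _ by constructor <;> norm_num)
  have h0 : 0 < b := lt_trans (by norm_num) hb.1
  have h1 : b < 1 := lt_trans hb.2 (by norm_num)
  have hanti : StrictAntiOn (fun x : ℝ => -x + 1 / 24 * (11 - 5 * x ^ 4)) (Set.Icc 0 1) := by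
    intro x hx y hy hxy
    have := pow_le_pow_left₀ hx.1 hxy.le 4
    dsimp only
    linarith
  obtain ⟨p, hp, hp'⟩ := exists_cutoff_eq (c := 5 / 6) (by norm_num) h0.le
  have l3 := pow_lt_pow_left₀ hb.1 (by norm_num) three_ne_zero
  have u3 := pow_lt_pow_left₀ hb.2 h0.le three_ne_zero
  refine ⟨⟨b, h0.le, h1.le⟩, p, hb.1, hb.2, ?_, ?_, fun x hx => ?_, hp⟩
  · rw [hp', lt_div_iff₀ (by positivity)]
    linarith
  · rw [hp', div_lt_iff₀ (by positivity)]
    linarith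
  · constructor
    · intro h
      exact hanti.injOn hx ⟨h0.le, h1.le⟩ (h.trans hb0.symm)
    · rintro rfl
      exact hb0

theorem exists_critical_three_six : ∃ b p : Set.Icc (0 : ℝ) 1,
    0.520 < (b : ℝ) ∧ (b : ℝ) < 0.521 ∧ 0.833 < (p : ℝ) ∧ (p : ℝ) < 0.834 ∧
    0.421 < fB 3 b ∧ fB 3 b < 0.422 ∧
    (∀ x ∈ Set.Icc (0 : ℝ) 1, fB 3 x = fB 6 x ↔ x = b) ∧
    17 / 12 * p * (b : ℝ) ^ 3 = 1 - p := by
  have hcont : ContinuousOn (fun x : ℝ => fB 6 x - fB 3 x) (Set.Icc 0.520 0.521) := by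
    simp only [fB_three, fB_six]
    fun_prop
  obtain ⟨b, hb, hb0⟩ := intermediate_value_Ioo' (by norm_num) hcont
    (show (0 : ℝ) ∈ _ by simp only [fB_three, fB_six]; constructor <;> norm_num)
  have h0 : 0 < b := lt_trans (by norm_num) hb.1
  have h1 : b < 1 := lt_trans hb.2 (by norm_num)
  obtain ⟨p, hp, hp'⟩ := exists_cutoff_eq (c := 17 / 12) (by norm_num) h0.le
  have l2 := pow_lt_pow_left₀ hb.1 (by norm_num) two_ne_zero
  have u2 := pow_lt_pow_left₀ hb.2 h0.le two_ne_zero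
  have l3 := pow_lt_pow_left₀ hb.1 (by norm_num) three_ne_zero
  have u3 := pow_lt_pow_left₀ hb.2 h0.le three_ne_zero
  refine ⟨⟨b, h0.le, h1.le⟩, p, hb.1, hb.2, ?_, ?_, ?_, ?_, fun x hx => ?_, hp⟩
  · rw [hp', lt_div_iff₀ (by positivity)]
    linarith
  · rw [hp', div_lt_iff₀ (by positivity)]
    linarith
  · rw [fB_three]
    dsimp only
    norm_num at *
    linarith
  -- Bounding `b ^ 2` and `b ^ 3` separately is too crude for `0.422`; instead `fB 3 0.521 - fB 3 b`
  -- is factored as `0.521 - b` times this quantity.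
  · have hfac : 0 < (0.521 + b) / 2 - (0.521 ^ 2 + 0.521 * b + b ^ 2) / 3 := by
      linarith [hb.1, hb.2]
    have := mul_pos (sub_pos.2 hb.2) hfac
    rw [fB_three]
    dsimp only
    norm_num at *
    linarith
  · constructor
    · intro h
      exact strictAntiOn_fB_sub.injOn hx ⟨h0.le, h1.le⟩
        ((sub_eq_zero.2 h.symm).trans hb0.symm)
    · rintro rfl
      exact (sub_eq_zero.1 hb0).symm

theorem strictMonoOn_optValue_one_four {b p : Set.Icc (0 : ℝ) 1}
    (hbp : 5 / 6 * p * (b : ℝ) ^ 3 = 1 - p) (hb : -(b : ℝ) + 1 / 24 * (11 - 5 * (b : ℝ) ^ 4) = 0) :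
    StrictMonoOn (fun q => optValue W (twoPoint 1 4 q)) (Set.Ici p) := by
  refine strictMonoOn_optValue (f := fun x => x) (g := fun x => (11 - 5 * x ^ 4) / 24)
    (c := 5 / 6) (by norm_num) (fun q x hx h => ?_) (fun q x hx h => ?_) hbp fun x hx => ?_
  · rw [optValue_twoPoint_one_four hx h, wA_eq]
  · have := strictAntiOn_wA hx.1 q.2.1 h
    simp only [wA_eq] at this
    exact this
  · have := pow_le_pow_left₀ hx.1 hx.2 4
    linarith [hx.2]

theorem strictMonoOn_optValue_three_six {b p : Set.Icc (0 : ℝ) 1}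
    (hbp : 17 / 12 * p * (b : ℝ) ^ 3 = 1 - p) (hb : fB 3 b = fB 6 b) :
    StrictMonoOn (fun q => optValue W (twoPoint 3 6 q)) (Set.Ici p) := by
  refine strictMonoOn_optValue (f := fB 3) (g := fB 6)
    (c := 17 / 12) (by norm_num) (fun q x hx h => ?_) (fun q x hx h => ?_) hbp fun x hx => ?_
  · rw [optValue_twoPoint_three_six hx h, wB]
  · exact strictAntiOn_wB hx.1 q.2.1 h
  · have := strictAntiOn_fB_sub.antitoneOn ⟨hx.1, hx.2.trans b.2.2⟩ b.2 hx.2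
    linarith

end BestChoice

/-! ### Assembly of the counter-examples -/

theorem mainTheorem9 :
    -- monotonicity fails, with attained maxima, under both conventions for not stopping at `n = 1`
    (∃ ν ν' : PMF ℕ+, StochLT ν ν' ∧ ∃ τ τ' : Strategy,
      IsOptimal W τ ν ∧ IsOptimal W τ' ν' ∧ W τ ν < W τ' ν') ∧
    (∃ ν ν' : PMF ℕ+, StochLT ν ν' ∧ ∃ τ τ' : Strategy,
      IsOptimal altW τ ν ∧ IsOptimal altW τ' ν' ∧ altW τ ν < altW τ' ν') ∧
    ¬ StochMonotone W ∧ ¬ StochMonotone altW ∧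
    -- the example on {1, 4}
    ((∀ p q : Set.Icc (0 : ℝ) 1, p < q → StochLT (twoPoint 1 4 p) (twoPoint 1 4 q)) ∧
      (∀ b p : Set.Icc (0 : ℝ) 1, W (strategyA b) (twoPoint 1 4 p) = wA b p ∧
        wA b p = (1 - p) * b + p / 24 * (11 - 5 * (b : ℝ) ^ 4)) ∧
      (∀ p : Set.Icc (0 : ℝ) 1, (p : ℝ) ≤ 6 / 11 → IsOptimal W (strategyA 1) (twoPoint 1 4 p)) ∧
      (∀ p : Set.Icc (0 : ℝ) 1, 6 / 11 < (p : ℝ) → ∃ b : ℝ, 0 ≤ b ∧ b < 1 ∧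
        ((p : ℝ) < 1 → 0 < b) ∧
        StrictMonoOn (fun x => wA x p) (Set.Icc 0 b) ∧
        StrictAntiOn (fun x => wA x p) (Set.Icc b 1) ∧
        IsOptimal W (strategyA b) (twoPoint 1 4 p)) ∧
      s 2 4 = 11 / 24 ∧ winProb (dStrategy 2) 4 = s 2 4 ∧
      IsOptimal W (dStrategy 2) (PMF.pure 4) ∧ optValue W (PMF.pure 4) = s 2 4 ∧
      twoPoint 1 4 ⟨1, by norm_num⟩ = PMF.pure 4 ∧
      ∃ b p : Set.Icc (0 : ℝ) 1,
        0.449 < (b : ℝ) ∧ (b : ℝ) < 0.450 ∧ 0.929 < (p : ℝ) ∧ (p : ℝ) < 0.930 ∧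
        (∀ x ∈ Set.Icc (0 : ℝ) 1, -x + 1 / 24 * (11 - 5 * x ^ 4) = 0 ↔ x = b) ∧
        (∀ q : Set.Icc (0 : ℝ) 1, wA b q = b) ∧
        (∀ x ∈ Set.Icc (0 : ℝ) 1, wA x p ≤ wA b p) ∧
        IsOptimal W (strategyA b) (twoPoint 1 4 p) ∧
        optValue W (twoPoint 1 4 p) = b ∧ (b : ℝ) < s 2 4 ∧
        StochLT (twoPoint 1 4 p) (PMF.pure 4) ∧
        (∀ q, (b : ℝ) ≤ optValue W (twoPoint 1 4 q)) ∧
        (∀ q, p < q → (b : ℝ) < optValue W (twoPoint 1 4 q) ∧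
          optValue W (twoPoint 1 4 q) ≤ s 2 4) ∧
        StrictMonoOn (fun q => optValue W (twoPoint 1 4 q)) (Set.Ici p)) ∧
    -- the example on {3, 6}
    ((∀ p q : Set.Icc (0 : ℝ) 1, p < q → StochLT (twoPoint 3 6 p) (twoPoint 3 6 q)) ∧
      (∀ b : Set.Icc (0 : ℝ) 1,
        winProb (strategyB b) 3 = fB 3 b ∧ winProb (strategyB b) 6 = fB 6 b) ∧
      (∀ b p : Set.Icc (0 : ℝ) 1, W (strategyB b) (twoPoint 3 6 p) = wB b p) ∧
      (∀ p, ∀ τ, altW τ (twoPoint 3 6 p) = W τ (twoPoint 3 6 p)) ∧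
      (∀ p : Set.Icc (0 : ℝ) 1, (p : ℝ) ≤ 12 / 29 → IsOptimal W (strategyB 1) (twoPoint 3 6 p)) ∧
      (∀ p : Set.Icc (0 : ℝ) 1, 12 / 29 < (p : ℝ) →
        IsOptimal W (strategyB ((12 * (1 - p) / (17 * p)) ^ (1 / 3 : ℝ))) (twoPoint 3 6 p)) ∧
      ∃ b p : Set.Icc (0 : ℝ) 1, ∃ v : ℝ,
        0.520 < (b : ℝ) ∧ (b : ℝ) < 0.521 ∧ 0.833 < (p : ℝ) ∧ (p : ℝ) < 0.834 ∧
        0.421 < v ∧ v < 0.422 ∧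
        (∀ x ∈ Set.Icc (0 : ℝ) 1, fB 3 x = fB 6 x ↔ x = b) ∧
        (∀ x ∈ Set.Icc (0 : ℝ) 1, 17 / 72 * x ^ 6 - 17 / 60 * x ^ 5 + 1 / 3 * x ^ 3
          - 1 / 2 * x ^ 2 + 17 / 180 = 0 ↔ x = b) ∧
        (∀ q : Set.Icc (0 : ℝ) 1, wB b q = v) ∧
        (∀ x ∈ Set.Icc (0 : ℝ) 1, wB x p ≤ wB b p) ∧
        IsOptimal W (strategyB b) (twoPoint 3 6 p) ∧
        optValue W (twoPoint 3 6 p) = v ∧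
        (∀ q, v ≤ optValue W (twoPoint 3 6 q)) ∧
        StrictMonoOn (fun q => optValue W (twoPoint 3 6 q)) (Set.Ici p)) := by
  obtain ⟨bA, pA, hA1, hA2, hA3, hA4, hAr, hAp⟩ := exists_critical_one_four
  obtain ⟨bB, pB, hB1, hB2, hB3, hB4, hB5, hB6, hBr, hBp⟩ := exists_critical_three_six
  have hAroot := (hAr bA bA.2).2 rfl
  have hBroot := (hBr bB bB.2).2 rfl
  have hAmono := strictMonoOn_optValue_one_four hAp hAroot
  have hBmono := strictMonoOn_optValue_three_six hBp hBroot
  have hAopt := isOptimal_strategyA bA.2 hAp.le fun _ => hAp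
  have hBopt := isOptimal_strategyB bB.2 hBp.le fun _ => hBp
  have hBopt1 : IsOptimal W (strategyB 0) (twoPoint 3 6 1) :=
    isOptimal_strategyB (by simp) (by simp) (by simp)
  have hwA : ∀ q : Set.Icc (0 : ℝ) 1, wA bA q = bA := fun q => by
    rw [wA_eq]
    linear_combination (q : ℝ) * hAroot
  have hwB : ∀ q : Set.Icc (0 : ℝ) 1, wB bB q = fB 3 bB := fun q => by
    rw [wB, ← hBroot]
    ring
  have hpA1 : pA < 1 := Subtype.coe_lt_coe.1 (hA4.trans (by norm_num))
  have hpB1 : pB < 1 := Subtype.coe_lt_coe.1 (hB4.trans (by norm_num))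
  have hvA : optValue W (twoPoint 1 4 pA) = bA := by
    rw [optValue_twoPoint_one_four bA.2 hAp, hwA]
  have hvB : optValue W (twoPoint 3 6 pB) = fB 3 bB := by
    rw [optValue_twoPoint_three_six bB.2 hBp, hwB]
  have hpure : twoPoint 1 4 1 = PMF.pure 4 := twoPoint_one 1 4 _
  -- The law at the saddle point against the point mass at `6`: this one pair serves both
  -- conventions.
  have hlt : StochLT (twoPoint 3 6 pB) (twoPoint 3 6 1) := stochLT_twoPoint (by decide) hpB1
  have hlt' : W (strategyB bB) (twoPoint 3 6 pB) < W (strategyB 0) (twoPoint 3 6 1) := by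
    rw [← optValue_eq_of_isOptimal hBopt, ← optValue_eq_of_isOptimal hBopt1]
    exact hBmono (Set.mem_Ici.2 le_rfl) hpB1.le hpB1
  have halt : ∀ p, ∀ τ, altW τ (twoPoint 3 6 p) = W τ (twoPoint 3 6 p) := fun p τ =>
    altW_twoPoint (by decide) (by decide) p τ
  have haltopt : ∀ {p τ}, IsOptimal W τ (twoPoint 3 6 p) → IsOptimal altW τ (twoPoint 3 6 p) :=
    fun h σ => by
      rw [halt, halt]
      exact h σ
  have hlt'' : altW (strategyB bB) (twoPoint 3 6 pB) < altW (strategyB 0) (twoPoint 3 6 1) := by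
    rw [halt, halt]
    exact hlt'
  refine ⟨⟨_, _, hlt, _, _, hBopt, hBopt1, hlt'⟩,
    ⟨_, _, hlt, _, _, haltopt hBopt, haltopt hBopt1, hlt''⟩, fun hmon => ?_, fun hmon => ?_,
    ⟨fun p q => stochLT_twoPoint (by decide), fun b p => ⟨W_strategyA_eq_wA b p, ?_⟩, fun p hp => ?_,
      fun p hp => ?_, s_two_four, winProb_dStrategy_two, isOptimal_dStrategy_two,
      optValue_pure_four, twoPoint_one _ _ _, bA, pA, hA1, hA2, hA3, hA4, hAr, hwA,
      fun x hx => ?_, hAopt, hvA, ?_, ?_, fun q => ?_, fun q hq => ⟨?_, ?_⟩, hAmono⟩,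
    ⟨fun p q => stochLT_twoPoint (by decide), winProb_strategyB, W_strategyB_eq_wB, halt,
      fun p hp => ?_, fun p hp => ?_, bB, pB, fB 3 bB, hB1, hB2, hB3, hB4, hB5, hB6, hBr,
      fun x hx => ?_, hwB, fun x hx => ?_, hBopt, hvB, fun q => ?_, hBmono⟩⟩
  · have := hmon _ _ hlt
    rw [optValue_eq_of_isOptimal hBopt, optValue_eq_of_isOptimal hBopt1] at this
    exact this.not_gt hlt'
  · have := hmon _ _ hlt
    rw [optValue_eq_of_isOptimal (haltopt hBopt), optValue_eq_of_isOptimal (haltopt hBopt1)] at this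
    exact this.not_gt hlt''
  · rw [wA_eq]
    ring
  · exact isOptimal_strategyA (by norm_num) (by linarith) fun h => absurd h (lt_irrefl _)
  · have hp0 : 0 < (p : ℝ) := lt_trans (by norm_num) hp
    have hx0 : 0 ≤ (1 - (p : ℝ)) / (5 / 6 * p) :=
      div_nonneg (sub_nonneg.2 p.2.2) (by positivity)
    obtain ⟨h1, h2⟩ := cubeRoot_spec hx0
    set b := ((1 - (p : ℝ)) / (5 / 6 * p)) ^ (1 / 3 : ℝ) with hb
    have heq : 5 / 6 * p * b ^ 3 = 1 - p := by
      rw [h2]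
      field_simp
    have hb1 : b < 1 := by
      refine lt_of_pow_lt_pow_left₀ 3 zero_le_one ?_
      rw [h2, div_lt_iff₀ (by positivity)]
      linarith
    refine ⟨b, h1, hb1, fun hp1 => ?_, strictMonoOn_wA hp0.le heq, strictAntiOn_wA h1 hp0.le heq,
      isOptimal_strategyA ⟨h1, hb1.le⟩ heq.le fun _ => heq⟩
    exact Real.rpow_pos_of_pos (div_pos (sub_pos.2 hp1) (by positivity)) _
  · rw [← W_strategyA_eq_wA ⟨x, hx⟩, ← W_strategyA_eq_wA]
    exact hAopt _
  · rw [s_two_four]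
    exact hA2.trans (by norm_num)
  · rw [← hpure]
    exact stochLT_twoPoint (by decide) hpA1
  · rw [← hwA q, ← W_strategyA_eq_wA]
    exact W_twoPoint_le_optValue (by decide) _ _
  · rw [← hvA]
    exact hAmono (Set.mem_Ici.2 le_rfl) hq.le hq
  -- The upper bound is the value at the right end `q = 1` of the increasing branch.
  · rw [← optValue_pure_four, ← hpure]
    exact hAmono.monotoneOn hq.le hpA1.le q.2.2
  · exact isOptimal_strategyB (by norm_num) (by linarith) fun h => absurd h (lt_irrefl _)
  · have hp0 : 0 < (p : ℝ) := lt_trans (by norm_num) hp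
    have hx0 : 0 ≤ 12 * (1 - (p : ℝ)) / (17 * p) :=
      div_nonneg (mul_nonneg (by norm_num) (sub_nonneg.2 p.2.2)) (by positivity)
    obtain ⟨h1, h2⟩ := cubeRoot_spec hx0
    have heq : 17 / 12 * p * ((12 * (1 - (p : ℝ)) / (17 * p)) ^ (1 / 3 : ℝ)) ^ 3 = 1 - p := by
      rw [h2]
      field_simp
    refine isOptimal_strategyB ⟨h1, ?_⟩ heq.le fun _ => heq
    refine le_of_pow_le_pow_left₀ three_ne_zero zero_le_one ?_
    rw [h2, div_le_iff₀ (by positivity)]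
    linarith
  · rw [← hBr x hx, fB_three, fB_six]
    constructor <;> intro h <;> linarith
  · rw [← W_strategyB_eq_wB ⟨x, hx⟩, ← W_strategyB_eq_wB]
    exact hBopt _
  · rw [← hwB q, ← W_strategyB_eq_wB]
    exact W_twoPoint_le_optValue (by decide) _ _
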